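/- Let $X$ be a complex Banach space, $E=\ell^2(\mathbb Z,X)$ with norm $\|x\|=(\sum_j\|x_j\|_X^2)^{1/2}$, and let $A$ be a bounded linear operator on $E$ whose matrix representation $[a_{i,j}]_{i,j\in\mathbb Z}$, $a_{i,j}\in L(X)$, is tridiagonal, i.e. $a_{i,j}=0$ for $|i-j|>1$. Put $\alpha_j=a_{j+1,j}$, $\gamma_j=a_{j-1,j}$, and let $\|\cdot\|_\infty$ denote the norm of $\ell^\infty(\mathbb Z,L(X))$. For a bounded operator $B$ on a complex Banach space let $$\operatorname{spec}_\varepsilon B=\{\lambda\in\mathbb C: 1/\|(B-\lambda I)^{-1}\|<\varepsilon\}\ (\varepsilon>0),\qquad \operatorname{Spec}_\varepsilon B=\{\lambda\in\mathbb C: 1/\|(B-\lambda I)^{-1}\|\le\varepsilon\}\ (\varepsilon\ge0),$$ where $\|(B-\lambda I)^{-1}\|:=\infty$ if $B-\lambda I$ is not invertible and $1/\infty:=0$, so that $\operatorname{Spec}_0B=\operatorname{Spec}B$ is the spectrum. For $n\in\mathbb N=\{1,2,\dots\}$, $k\in\mathbb Z$ and $\mathfrak a,\mathfrak c\in\ell^\infty(\mathbb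 Z,L(X))$ let $A_{n,k}=[a_{i,j}]_{i,j=k+1}^{k+n}$, and let $A^{\mathfrak a,\mathfrak c}_{n,k}$ be $A_{n,k}$ with $\mathfrak a_k$ added to its top right entry and $\mathfrak c_k$ added to its bottom left entry, acting on $X^n$ with norm $(\sum_j\|\xi_j\|_X^2)^{1/2}$. For $t\in\mathbb T=\{z\in\mathbb C:|z|=1\}$ let $A^{\mathrm{per},t}_{n,k}$ be this matrix for $\mathfrak a_k=t\alpha_k$, $\mathfrak c_k=\bar t\gamma_{k+n+1}$. Put $$\pi^{n,\mathfrak a,\mathfrak c}_\varepsilon(A)=\bigcup_{k\in\mathbb Z}\operatorname{spec}_\varepsilon A^{\mathfrak a,\mathfrak c}_{n,k},\qquad \Pi^{n,\mathfrak a,\mathfrak c}_\varepsilon(A)=\overline{\bigcup_{k\in\mathbb Z}\operatorname{Spec}_\varepsilon A^{\mathfrak a,\mathfrak c}_{n,k}},$$ and define $\pi^{n,t}_\varepsilon(A)$, $\Pi^{n,t}_\varepsilon(A)$ in the same way from $A^{\mathrm{per},t}_{n,k}$. $X$ has Globevnik's property if $X$ is finite-dimensional or $X$ or its dual $X^*$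 is complex uniformly convex ($Y$ is complex uniformly convex if for every $\varepsilon>0$ there is $\delta>0$ such that $\|x\|\le1-\delta$ whenever $x,y\in Y$, $\|y\|\ge\varepsilon$ and $\|x+\zeta y\|\le1$ for all $\zeta\in\mathbb C$ with $|\zeta|\le1$). (a) Let $n\in\mathbb N$, let $\mathfrak a,\mathfrak c\in\ell^\infty(\mathbb Z,L(X))$ with $\|\mathfrak a\|_\infty\le\|\alpha\|_\infty$ and $\|\mathfrak c\|_\infty\le\|\gamma\|_\infty$, and let $w_1,\dots,w_n\ge0$ be not all zero. Then the inclusions $$\operatorname{spec}_\varepsilon A\subset\pi^{n,\mathfrak a,\mathfrak c}_{\varepsilon+\varepsilon'_n}(A)\quad(\varepsilon>0)\qquad\text{and, if $X$ has Globevnik's property,}\qquad \operatorname{Spec}_\varepsilon A\subset\Pi^{n,\mathfrak a,\mathfrak c}_{\varepsilon+\varepsilon'_n}(A)\quad(\varepsilon\ge0)$$ hold with $\varepsilon'_n=(\|\alpha\|_\infty+\|\gamma\|_\infty)\sqrt{T_n/S_n}$, where $S_n=\sum_{j=1}^nw_j^2$ and $T_n=(w_1+w_n)^2+\sum_{j=1}^{n-1}(w_{j+1}-w_j)^2$;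 the case $\varepsilon=0$ of the second inclusion is claimed only if $\|\alpha\|_\infty+\|\gamma\|_\infty>0$ or $X$ is finite-dimensional. (b) The same two inclusions (with the same proviso for $\varepsilon=0$) hold with $$\varepsilon'_n=2(\|\alpha\|_\infty+\|\gamma\|_\infty)\sin\frac{\pi}{2n}.$$ (c) In particular, with $\varepsilon'_n$ as in (b), for all $n\in\mathbb N$ and $t\in\mathbb T$, $$\operatorname{spec}_\varepsilon A\subset\pi^{n,t}_{\varepsilon+\varepsilon'_n}(A)\quad(\varepsilon>0),\qquad\text{and, if $X$ has Globevnik's property,}\qquad \operatorname{Spec}_\varepsilon A\subset\Pi^{n,t}_{\varepsilon+\varepsilon'_n}(A)\quad(\varepsilon\ge0),$$ with the same proviso for $\varepsilon=0$. (d) The value of $\varepsilon'_n$ in (b) and (c) is best possible: for the shift operator $V$ on $\ell^2(\mathbb Z,\mathbb C)$, $(Vx)_i=x_{i-1}$, which is bounded and tridiagonal with $\|\alpha\|_\infty=1$, $\|\gamma\|_\infty=0$, so that $\varepsilon'_n=2\sin\frac{\pi}{2n}$, and for all $n\in\mathbb N$ and $t\in\mathbb T$: $\operatorname{Spec}V\not\subset\pi^{n,t}_{\varepsilon'_n}(V)$;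 and for every $0\le\delta<\varepsilon'_n$, $\operatorname{Spec}V\not\subset\Pi^{n,t}_{\delta}(V)$ and there is $\varepsilon>0$ with $\operatorname{spec}_\varepsilon V\not\subset\pi^{n,t}_{\varepsilon+\delta}(V)$. -/

import Mathlib

open scoped ENNReal

noncomputable section

namespace PiMethod

universe u

/-- The Banach space `ℓ²(ℤ, X)` of square-summable bi-infinite `X`-valued sequences. -/
abbrev BiSeq (X : Type u) [NormedAddCommGroup X] : Type u := lp (fun _ : ℤ => X) 2

/-- The Banach space `ℓ^∞(ℤ, L(X))` with the supremum norm. -/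
abbrev BddOpSeq (X : Type u) [NormedAddCommGroup X] [NormedSpace ℂ X] : Type u :=
  lp (fun _ : ℤ => X →L[ℂ] X) ∞

/-- The space `X^n` with the norm `(∑ ‖ξ_j‖²)^{1/2}`. -/
abbrev FinSeq (X : Type u) [NormedAddCommGroup X] (n : ℕ) : Type u :=
  PiLp 2 (fun _ : Fin n => X)

section Pseudospectra

variable {Y : Type u} [NormedAddCommGroup Y] [NormedSpace ℂ Y]

open Classical in
/-- `‖B⁻¹‖`, with the convention that this is `∞` if `B` is not invertible in `L(Y)`. -/
def invNorm (B : Y →L[ℂ] Y) : ℝ≥0∞ :=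
  if IsUnit B then ‖Ring.inverse B‖ₑ else ∞

/-- The open `ε`-pseudospectrum `{z : 1 / ‖(B - z I)⁻¹‖ < ε}` (where `1 / ∞ = 0`). -/
def openPseudospectrum (ε : ℝ) (B : Y →L[ℂ] Y) : Set ℂ :=
  {z | (invNorm (B - z • (1 : Y →L[ℂ] Y)))⁻¹ < ENNReal.ofReal ε}

/-- The closed `ε`-pseudospectrum `{z : 1 / ‖(B - z I)⁻¹‖ ≤ ε}` (where `1 / ∞ = 0`); for `ε = 0`
this is the spectrum, see `closedPseudospectrum_zero`. -/
def closedPseudospectrum (ε : ℝ) (B : Y →L[ℂ] Y) : Set ℂ :=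
  {z | (invNorm (B - z • (1 : Y →L[ℂ] Y)))⁻¹ ≤ ENNReal.ofReal ε}

theorem closedPseudospectrum_zero (B : Y →L[ℂ] Y) :
    closedPseudospectrum 0 B = spectrum ℂ B := by
  ext z
  have h : IsUnit (B - z • (1 : Y →L[ℂ] Y)) ↔
      IsUnit (algebraMap ℂ (Y →L[ℂ] Y) z - B) := by
    rw [← IsUnit.neg_iff, neg_sub, Algebra.algebraMap_eq_smul_one]
  simp only [closedPseudospectrum, Set.mem_ofPred_eq, spectrum.mem_iff, ← h, invNorm]
  split_ifs with h1 <;> simp [h1]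

end Pseudospectra

/-- `Y` is complex uniformly convex. -/
def ComplexUniformlyConvex (Y : Type u) [NormedAddCommGroup Y] [NormedSpace ℂ Y] : Prop :=
  ∀ ε : ℝ, 0 < ε → ∃ δ : ℝ, 0 < δ ∧ ∀ x y : Y, ε ≤ ‖y‖ →
    (∀ ζ : ℂ, ‖ζ‖ ≤ 1 → ‖x + ζ • y‖ ≤ 1) → ‖x‖ ≤ 1 - δ

/-- Globevnik's property: `Y` is finite-dimensional, or `Y` or its dual is complex uniformly
convex. -/
def GlobevnikProperty (Y : Type u) [NormedAddCommGroup Y] [NormedSpace ℂ Y] : Prop :=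
  FiniteDimensional ℂ Y ∨ ComplexUniformlyConvex Y ∨ ComplexUniformlyConvex (StrongDual ℂ Y)

section Operators

variable {X : Type u} [NormedAddCommGroup X] [NormedSpace ℂ X]

/-- The entry `a_{i,j} ∈ L(X)` of the matrix representation of `A ∈ L(ℓ²(ℤ, X))`. -/
def entry (A : BiSeq X →L[ℂ] BiSeq X) (i j : ℤ) : X →L[ℂ] X :=
  (lp.evalCLM ℂ (fun _ : ℤ => X) 2 i).comp
    (A.comp (lp.singleContinuousLinearMap ℂ (fun _ : ℤ => X) 2 j))

theorem entry_apply (A : BiSeq X →L[ℂ] BiSeq X) (i j : ℤ) (x : X) :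
    entry A i j x = (A (lp.single 2 j x) : BiSeq X) i := rfl

theorem norm_entry_le (A : BiSeq X →L[ℂ] BiSeq X) (i j : ℤ) : ‖entry A i j‖ ≤ ‖A‖ := by
  refine ContinuousLinearMap.opNorm_le_bound _ (norm_nonneg _) fun x => ?_
  rw [entry_apply]
  refine (lp.norm_apply_le_norm (by norm_num) _ i).trans ((A.le_opNorm _).trans_eq ?_)
  rw [lp.norm_single (by norm_num)]

/-- The matrix representation of `A` is tridiagonal. -/
def IsTridiagonal (A : BiSeq X →L[ℂ] BiSeq X) : Prop :=
  ∀ i j : ℤ, 1 < |i - j| → entry A i j = 0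

/-- The subdiagonal `α`, `α_j = a_{j+1,j}`, as an element of `ℓ^∞(ℤ, L(X))`. -/
def subdiag (A : BiSeq X →L[ℂ] BiSeq X) : BddOpSeq X :=
  ⟨fun j => entry A (j + 1) j, memℓp_infty ⟨‖A‖, by
    rintro _ ⟨j, rfl⟩
    exact norm_entry_le A _ _⟩⟩

/-- The superdiagonal `γ`, `γ_j = a_{j-1,j}`, as an element of `ℓ^∞(ℤ, L(X))`. -/
def superdiag (A : BiSeq X →L[ℂ] BiSeq X) : BddOpSeq X :=
  ⟨fun j => entry A (j - 1) j, memℓp_infty ⟨‖A‖, by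
    rintro _ ⟨j, rfl⟩
    exact norm_entry_le A _ _⟩⟩

/-- The operator on `X^n` given by multiplication by an `n × n` matrix with entries in `L(X)`. -/
def matOp {n : ℕ} (M : Fin n → Fin n → X →L[ℂ] X) : FinSeq X n →L[ℂ] FinSeq X n :=
  ((PiLp.continuousLinearEquiv 2 ℂ (fun _ : Fin n => X)).symm :
      (Fin n → X) →L[ℂ] FinSeq X n).comp
    (ContinuousLinearMap.pi fun i =>
      ∑ j : Fin n, (M i j).comp (PiLp.proj (𝕜 := ℂ) 2 (fun _ : Fin n => X) j))

theorem matOp_apply {n : ℕ} (M : Fin n → Fin n → X →L[ℂ] X) (x : FinSeq X n) (i : Fin n) :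
    matOp M x i = ∑ j : Fin n, M i j (x j) := by
  simp [matOp]

/-- The `n × n` matrix `A_{n,k} + B`, where `A_{n,k}` is the principal submatrix of `A` with rows
and columns `k+1, …, k+n`, and where the only entries of `B` are `a` in the top right corner
and `c` in the bottom left corner (they are added if `n = 1`), as an operator on `X^n`.
Indices in `Fin n` start from `0`. -/
def cornerSection (A : BiSeq X →L[ℂ] BiSeq X) (n : ℕ) (k : ℤ) (a c : X →L[ℂ] X) :
    FinSeq X n →L[ℂ] FinSeq X n :=
  matOp fun i j : Fin n =>
    entry A (k + 1 + (i : ℕ)) (k + 1 + (j : ℕ))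
      + (if (i : ℕ) = 0 ∧ (j : ℕ) + 1 = n then a else 0)
      + (if (i : ℕ) + 1 = n ∧ (j : ℕ) = 0 then c else 0)

/-- `A^{𝔞,𝔠}_{n,k}`. -/
def genSection (A : BiSeq X →L[ℂ] BiSeq X) (𝔞 𝔠 : BddOpSeq X) (n : ℕ) (k : ℤ) :
    FinSeq X n →L[ℂ] FinSeq X n :=
  cornerSection A n k (𝔞 k) (𝔠 k)

/-- The periodised finite section `A^{per,t}_{n,k}`: the corner entries are `t α_k` (top right)
and `conj t γ_{k+n+1}` (bottom left). -/
def perSection (A : BiSeq X →L[ℂ] BiSeq X) (t : ℂ) (n : ℕ) (k : ℤ) :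
    FinSeq X n →L[ℂ] FinSeq X n :=
  cornerSection A n k (t • subdiag A k) ((starRingEnd ℂ) t • superdiag A (k + n + 1))

/-- `π^{n,𝔞,𝔠}_ε(A)`. -/
def genOpenSet (A : BiSeq X →L[ℂ] BiSeq X) (𝔞 𝔠 : BddOpSeq X) (n : ℕ) (ε : ℝ) : Set ℂ :=
  ⋃ k : ℤ, openPseudospectrum ε (genSection A 𝔞 𝔠 n k)

/-- `Π^{n,𝔞,𝔠}_ε(A)`. -/
def genClosedSet (A : BiSeq X →L[ℂ] BiSeq X) (𝔞 𝔠 : BddOpSeq X) (n : ℕ) (ε : ℝ) : Set ℂ :=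
  closure (⋃ k : ℤ, closedPseudospectrum ε (genSection A 𝔞 𝔠 n k))

/-- `π^{n,t}_ε(A)`. -/
def perOpenSet (A : BiSeq X →L[ℂ] BiSeq X) (t : ℂ) (n : ℕ) (ε : ℝ) : Set ℂ :=
  ⋃ k : ℤ, openPseudospectrum ε (perSection A t n k)

/-- `Π^{n,t}_ε(A)`. -/
def perClosedSet (A : BiSeq X →L[ℂ] BiSeq X) (t : ℂ) (n : ℕ) (ε : ℝ) : Set ℂ :=
  closure (⋃ k : ℤ, closedPseudospectrum ε (perSection A t n k))

/-- The penalty term `(‖α‖_∞ + ‖γ‖_∞) (T_n / S_n)^{1/2}` given by the weights `w_1, …, w_n`. -/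
def weightedPenalty (A : BiSeq X →L[ℂ] BiSeq X) (n : ℕ) (w : ℕ → ℝ) : ℝ :=
  (‖subdiag A‖ + ‖superdiag A‖) *
    Real.sqrt (((w 1 + w n) ^ 2 + ∑ j ∈ Finset.Ico 1 n, (w (j + 1) - w j) ^ 2) /
      ∑ j ∈ Finset.Icc 1 n, w j ^ 2)

/-- The penalty term `ε'_n = 2 (‖α‖_∞ + ‖γ‖_∞) sin (π / (2n))`. -/
def penalty (A : BiSeq X →L[ℂ] BiSeq X) (n : ℕ) : ℝ :=
  2 * (‖subdiag A‖ + ‖superdiag A‖) * Real.sin (Real.pi / (2 * n))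

end Operators

end PiMethod

end

/-! Open inclusion. Suppose `z` lies in none of the open `(ε + ε')`-pseudospectra of the sections.
With `μ = ε + ε'`, every section minus `z` is invertible and satisfies `μ ‖ξ‖ ≤ ‖(section - z) ξ‖`.
For `x` in `ℓ²(ℤ, X)`, apply the `k`-th bound to the weighted cut-off `(w_j x_{k+j})_j` and sum the
squares over all `k`. The row of `A` acts on the cut-off up to a commutator, which involves only
differences of neighbouring weights. The corner rows contribute `w_1 + w_n`, because the arbitrary
corner entries are controlled by the triangle inequality alone. Minkowski's inequality then gives `μ
√S ‖x‖ ≤ √S ‖(A - z) x‖ + (‖α‖ + ‖γ‖) √T ‖x‖`, so `A - z` is bounded below by `ε`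
(`lower_bound_of_sections`).

For surjectivity, solve all section equations with right-hand sides `(w_j y_{k+j})_j` and paste the
solutions together with the same weights. After summation by parts, `S⁻¹` times the pasted vector
solves `(A - z) x = y` with relative error at most `ε' / (ε + ε') < 1`
(`approx_surjective_of_sections`). Closed range and Riesz's lemma finish the argument
(`isUnit_of_approx_surjective`).

The weights `sin ((2j - 1) π / (2n))` form an eigenvector of the antiperiodic second difference,
with eigenvalue `4 sin² (π / (2n))`; this gives the penalty in (b), and (c) is a choice of corners.

Closed inclusion. A point of the closed `ε`-pseudospectrum of `A` lies in the open `(ε +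
η)`-pseudospectrum for each `η > 0`, so the open inclusion applies. To let `η` tend to `0`, a
resolvent norm bounded on a disc by `1/μ` must be strictly smaller at the centre, uniformly over the
sections (`UniformResolventGap`). Complex uniform convexity gives this by a Fejér kernel estimate,
the dual case follows by transposition, and finite dimension by the maximum principle and
compactness.

Sharpness. The periodised sections of the shift are unitary with eigenvalues among the `n`-th roots
of `t`. A root of `z^n = -t` lies on the unit circle, the spectrum of the shift, at distance at
least `2 sin (π / (2n))` from all of them. -/

noncomputable section

namespace PiMethod

/-! ### Pseudospectra through lower bounds; a criterion for invertibility -/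

section Pseudospectra

variable {Y : Type*} [NormedAddCommGroup Y] [NormedSpace ℂ Y]

/-- Translates resolvent norms into lower bounds, the form used from here on. Positivity of `ε`
excludes noninvertible `C`, for which the right-hand side is `1 / ∞ = 0`. -/
theorem ofReal_le_inv_invNorm_iff {ε : ℝ} (hε : 0 < ε) (C : Y →L[ℂ] Y) :
    ENNReal.ofReal ε ≤ (invNorm C)⁻¹ ↔ IsUnit C ∧ ∀ x, ε * ‖x‖ ≤ ‖C x‖ := by
  by_cases hC : IsUnit C
  · have key : ENNReal.ofReal ε ≤ (invNorm C)⁻¹ ↔ ‖Ring.inverse C‖ ≤ ε⁻¹ := by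
      rw [invNorm, if_pos hC, ENNReal.le_inv_iff_le_inv, ← ENNReal.ofReal_inv_of_pos hε,
        ← ofReal_norm, ENNReal.ofReal_le_ofReal_iff (by positivity)]
    rw [key]
    refine ⟨fun h => ⟨hC, fun x => ?_⟩, fun h => ?_⟩
    · have hx : Ring.inverse C (C x) = x := by
        rw [← mul_apply_eq_comp, Ring.inverse_mul_cancel _ hC,
          one_apply_eq_self]
      have h2 := (Ring.inverse C).le_of_opNorm_le h (C x)
      rw [hx] at h2
      calc ε * ‖x‖ ≤ ε * (ε⁻¹ * ‖C x‖) := by gcongr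
        _ = ‖C x‖ := by field_simp
    · refine ContinuousLinearMap.opNorm_le_bound _ (by positivity) fun x => ?_
      have hx : C (Ring.inverse C x) = x := by
        rw [← mul_apply_eq_comp, Ring.mul_inverse_cancel _ hC,
          one_apply_eq_self]
      have h2 := h.2 (Ring.inverse C x)
      rw [hx] at h2
      rw [inv_mul_eq_div, le_div_iff₀ hε]
      linarith
  · simp [invNorm, hC, hε]

theorem notMem_openPseudospectrum_iff {ε : ℝ} (hε : 0 < ε) {B : Y →L[ℂ] Y} {z : ℂ} :
    z ∉ openPseudospectrum ε B ↔
      IsUnit (B - z • (1 : Y →L[ℂ] Y)) ∧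
        ∀ x, ε * ‖x‖ ≤ ‖(B - z • (1 : Y →L[ℂ] Y)) x‖ := by
  rw [← ofReal_le_inv_invNorm_iff hε, openPseudospectrum, Set.mem_ofPred_eq, not_lt]

theorem closedPseudospectrum_subset_openPseudospectrum {ε ε' : ℝ} (h : ε < ε') (h' : 0 < ε')
    (B : Y →L[ℂ] Y) : closedPseudospectrum ε B ⊆ openPseudospectrum ε' B :=
  fun _ hz => lt_of_le_of_lt hz ((ENNReal.ofReal_lt_ofReal_iff h').2 h)

theorem openPseudospectrum_subset_closedPseudospectrum (ε : ℝ) (B : Y →L[ℂ] Y) :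
    openPseudospectrum ε B ⊆ closedPseudospectrum ε B :=
  fun z hz => le_of_lt (show (invNorm (B - z • 1))⁻¹ < _ from hz)

theorem isUnit_of_notMem_closedPseudospectrum {ε : ℝ} {B : Y →L[ℂ] Y} {z : ℂ}
    (h : z ∉ closedPseudospectrum ε B) : IsUnit (B - z • (1 : Y →L[ℂ] Y)) := by
  by_contra hC
  exact h (by simp [closedPseudospectrum, invNorm, hC])

end Pseudospectra

/-- A bounded-below operator that approximately solves every equation with relative error `q < 1`
is invertible. -/
theorem isUnit_of_approx_surjective {Y : Type*} [NormedAddCommGroup Y] [NormedSpace ℂ Y]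
    [CompleteSpace Y] (B : Y →L[ℂ] Y) {c q : ℝ} (hc : 0 < c) (hq : q < 1)
    (hbelow : ∀ x, c * ‖x‖ ≤ ‖B x‖) (happrox : ∀ y, ∃ x, ‖y - B x‖ ≤ q * ‖y‖) : IsUnit B := by
  have hanti : AntilipschitzWith (Real.toNNReal c⁻¹) B :=
    ContinuousLinearMap.antilipschitz_of_bound B fun x => by
      rw [Real.coe_toNNReal _ (by positivity), inv_mul_eq_div, le_div_iff₀ hc]
      linarith [hbelow x]
  have hclosed : IsClosed (B.range : Set Y) := by
    have h := hanti.isClosed_range B.uniformContinuous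
    rwa [show Set.range B = (B.range : Set Y) from (LinearMap.coe_range _).symm] at h
  rw [ContinuousLinearMap.isUnit_iff_bijective]
  refine ⟨hanti.injective, ?_⟩
  by_contra hsurj
  obtain ⟨y, hy⟩ : ∃ y, y ∉ B.range := by
    by_contra! h
    exact hsurj fun y => by simpa using h y
  -- Since `(q + 1) / 2` exceeds `q`, the vector `y₀` is too far from the range to be solved with
  -- relative error `q`.
  obtain ⟨y₀, hy₀, h⟩ := riesz_lemma hclosed ⟨y, hy⟩ (r := (q + 1) / 2) (by linarith)
  obtain ⟨x, hx⟩ := happrox y₀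
  have h1 := h (B x) (by simp)
  have hy₀' : y₀ ≠ 0 := fun h0 => hy₀ (h0 ▸ Submodule.zero_mem _)
  nlinarith [norm_pos_iff.2 hy₀']

end PiMethod

/-! ### Shifts, multiplications and matrix rows on `ℓ²(ℤ, X)` -/

namespace PiMethod

variable {X : Type*} [NormedAddCommGroup X]

theorem summable_norm_sq (x : BiSeq X) : Summable fun k => ‖x k‖ ^ 2 := by
  simpa using (lp.memℓp x).summable (by norm_num)

theorem norm_sq_eq_tsum (x : BiSeq X) : ‖x‖ ^ 2 = ∑' k, ‖x k‖ ^ 2 := by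
  simpa using lp.norm_rpow_eq_tsum (p := 2) (by norm_num) x

theorem memlp_two_of_summable {f : ℤ → X} (h : Summable fun k => ‖f k‖ ^ 2) : Memℓp f 2 :=
  memℓp_gen (by simpa using h)

/-- An element of `ℓ²(ℤ, X)` dominated by a reindexed element. -/
theorem memlp_two_of_norm_le {f : ℤ → X} {c : ℝ} (g : BiSeq X) (σ : ℤ ≃ ℤ)
    (h : ∀ k, ‖f k‖ ≤ c * ‖g (σ k)‖) : Memℓp f 2 := by
  refine memlp_two_of_summable (.of_nonneg_of_le (fun k => by positivity)
    (fun k => pow_le_pow_left₀ (norm_nonneg _) (h k) 2) ?_)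
  simp only [mul_pow]
  exact (σ.summable_iff.2 (summable_norm_sq g)).mul_left _

theorem norm_le_of_norm_apply_le {f : BiSeq X} {c : ℝ} (hc : 0 ≤ c) (g : BiSeq X) (σ : ℤ ≃ ℤ)
    (h : ∀ k, ‖f k‖ ≤ c * ‖g (σ k)‖) : ‖f‖ ≤ c * ‖g‖ := by
  refine le_of_sq_le_sq ?_ (by positivity)
  rw [mul_pow, norm_sq_eq_tsum, norm_sq_eq_tsum, ← σ.tsum_eq fun k => ‖g k‖ ^ 2, ← tsum_mul_left]
  refine (summable_norm_sq f).tsum_le_tsum (fun k => ?_)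
    ((σ.summable_iff.2 (summable_norm_sq g)).mul_left _)
  rw [← mul_pow]
  exact pow_le_pow_left₀ (norm_nonneg _) (h k) 2

variable [NormedSpace ℂ X]

/-- The shift `(T_s x)_k = x_{k + s}`. -/
def shift (s : ℤ) : BiSeq X →L[ℂ] BiSeq X :=
  LinearMap.mkContinuous
    { toFun := fun x => ⟨fun k => x (k + s), memlp_two_of_norm_le (c := 1) x (Equiv.addRight s)
        fun k => by simp⟩
      map_add' := fun _ _ => rfl
      map_smul' := fun _ _ => rfl } 1
    fun x => norm_le_of_norm_apply_le zero_le_one x (Equiv.addRight s) fun _ => (one_mul _).ge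

@[simp] theorem shift_apply (s : ℤ) (x : BiSeq X) (k : ℤ) :
    (shift s x : BiSeq X) k = x (k + s) := rfl

@[simp] theorem norm_shift_apply (s : ℤ) (x : BiSeq X) : ‖shift s x‖ = ‖x‖ := by
  refine le_antisymm ?_ ?_
  · simpa using norm_le_of_norm_apply_le zero_le_one x (Equiv.addRight s) (f := shift s x)
      fun k => by simp
  · simpa using norm_le_of_norm_apply_le zero_le_one (shift s x) (Equiv.addRight (-s)) (f := x)
      fun k => by simp

/-- Multiplication by a bounded sequence of operators. -/
def mulSeq (b : BddOpSeq X) : BiSeq X →L[ℂ] BiSeq X :=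
  have h (x : BiSeq X) (k : ℤ) : ‖b k (x k)‖ ≤ ‖b‖ * ‖x (Equiv.refl ℤ k)‖ :=
    (b k).le_of_opNorm_le (lp.norm_apply_le_norm (by simp) b k) _
  LinearMap.mkContinuous
    { toFun := fun x => ⟨fun k => b k (x k), memlp_two_of_norm_le x (Equiv.refl ℤ) (h x)⟩
      map_add' := fun x y => by ext k; exact (b k).map_add _ _
      map_smul' := fun c x => by ext k; exact (b k).map_smul _ _ } ‖b‖
    fun x => norm_le_of_norm_apply_le (norm_nonneg _) x (Equiv.refl ℤ) (h x)

@[simp] theorem mulSeq_apply (b : BddOpSeq X) (x : BiSeq X) (k : ℤ) :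
    (mulSeq b x : BiSeq X) k = b k (x k) := rfl

theorem norm_mulSeq_apply_le (b : BddOpSeq X) (x : BiSeq X) : ‖mulSeq b x‖ ≤ ‖b‖ * ‖x‖ :=
  norm_le_of_norm_apply_le (norm_nonneg _) x (Equiv.refl ℤ) fun k =>
    (b k).le_of_opNorm_le (lp.norm_apply_le_norm (by simp) b k) _

@[simp] theorem subdiag_apply (A : BiSeq X →L[ℂ] BiSeq X) (k : ℤ) :
    subdiag A k = entry A (k + 1) k := rfl

@[simp] theorem superdiag_apply (A : BiSeq X →L[ℂ] BiSeq X) (k : ℤ) :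
    superdiag A k = entry A (k - 1) k := rfl

theorem hasSum_entry (A : BiSeq X →L[ℂ] BiSeq X) (x : BiSeq X) (i : ℤ) :
    HasSum (fun j => entry A i j (x j)) ((A x : BiSeq X) i) :=
  ((lp.evalCLM ℂ (fun _ : ℤ => X) 2 i).comp A).hasSum (lp.hasSum_single (by simp) x)

theorem IsTridiagonal.apply_eq {A : BiSeq X →L[ℂ] BiSeq X} (hA : IsTridiagonal A) (x : BiSeq X)
    (i : ℤ) : (A x : BiSeq X) i =
      entry A i (i - 1) (x (i - 1)) + entry A i i (x i) + entry A i (i + 1) (x (i + 1)) := by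
  refine (hasSum_entry A x i).unique ?_
  have h : HasSum (fun j => entry A i j (x j)) (∑ j ∈ {i - 1, i, i + 1}, entry A i j (x j)) :=
    hasSum_sum_of_ne_finset_zero (fun j hj => by
      simp only [Finset.mem_insert, Finset.mem_singleton, not_or] at hj
      rw [hA i j (by rcases abs_cases (i - j) with h | h <;> lia)]
      rfl)
  rwa [Finset.sum_insert (by simp; lia), Finset.sum_insert (by simp), Finset.sum_singleton,
    ← add_assoc] at h

theorem isTridiagonal_of_apply_eq {A : BiSeq X →L[ℂ] BiSeq X} {a b c : ℤ → X →L[ℂ] X}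
    (h : ∀ (x : BiSeq X) (i : ℤ), (A x : BiSeq X) i =
      a i (x (i - 1)) + b i (x i) + c i (x (i + 1))) : IsTridiagonal A := by
  intro i j hij
  ext x
  have h1 : i - 1 ≠ j ∧ i ≠ j ∧ i + 1 ≠ j := by
    rcases abs_cases (i - j) with h | h <;> lia
  rw [entry_apply, h, lp.single_apply_ne _ _ _ h1.1, lp.single_apply_ne _ _ _ h1.2.1,
    lp.single_apply_ne _ _ _ h1.2.2]
  simp

end PiMethod

/-! ### Finite sums and the rows of a section -/

namespace PiMethod

section Sums

theorem sum_range_eq_of_tridiagonal {M : Type*} [AddCommMonoid M] {N i : ℕ} (hi : i ≤ N)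
    (f : ℕ → M) (hf : ∀ j, j + 1 < i ∨ i + 1 < j → f j = 0) :
    ∑ j ∈ Finset.range (N + 1), f j =
      (if i = 0 then 0 else f (i - 1)) + f i + (if i = N then 0 else f (i + 1)) := by
  have key : ∀ j ∈ Finset.range (N + 1), f j = (if j + 1 = i then f j else 0) +
      (if j = i then f j else 0) + (if j = i + 1 then f j else 0) := by
    intro j _
    by_cases h1 : j + 1 < i ∨ i + 1 < j
    · simp [hf j h1]
    · rcases (by lia : j + 1 = i ∨ j = i ∨ j = i + 1) with rfl | rfl | rfl
      · simp [show j ≠ j + 1 + 1 by lia]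
      · simp
      · simp [show i + 1 + 1 ≠ i by lia]
  rw [Finset.sum_congr rfl key, Finset.sum_add_distrib, Finset.sum_add_distrib]
  congr 1
  · congr 1
    · rcases i with _ | i
      · simp
      · simp [show i < N + 1 by lia]
    · simp [show i < N + 1 by lia]
  · rcases eq_or_ne i N with rfl | h
    · simp
    · simp [h, show i < N by lia]

/-- Minkowski's inequality for three summands: multiply the pointwise bound by `p i`, sum, apply
Cauchy-Schwarz to each term and cancel one factor `√(∑ p²)`. -/
theorem sqrt_sum_sq_le {ι : Type*} (I : Finset ι) {p a b c : ι → ℝ} {s t r : ℝ}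
    (hs : 0 ≤ s) (ht : 0 ≤ t) (hr : 0 ≤ r) (hp : ∀ i ∈ I, 0 ≤ p i)
    (hpq : ∀ i ∈ I, p i ≤ s * a i + t * b i + r * c i) :
    √(∑ i ∈ I, p i ^ 2) ≤
      s * √(∑ i ∈ I, a i ^ 2) + t * √(∑ i ∈ I, b i ^ 2) + r * √(∑ i ∈ I, c i ^ 2) := by
  rcases (Real.sqrt_nonneg (∑ i ∈ I, p i ^ 2)).eq_or_lt with h0 | h0
  · rw [← h0]; positivity
  · have h1 : ∑ i ∈ I, p i ^ 2 ≤
        s * ∑ i ∈ I, p i * a i + t * ∑ i ∈ I, p i * b i + r * ∑ i ∈ I, p i * c i := by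
      simp only [Finset.mul_sum, ← Finset.sum_add_distrib]
      exact Finset.sum_le_sum fun i hi => by nlinarith [hp i hi, hpq i hi]
    have ha := mul_le_mul_of_nonneg_left (Real.sum_mul_le_sqrt_mul_sqrt I p a) hs
    have hb := mul_le_mul_of_nonneg_left (Real.sum_mul_le_sqrt_mul_sqrt I p b) ht
    have hc := mul_le_mul_of_nonneg_left (Real.sum_mul_le_sqrt_mul_sqrt I p c) hr
    rw [← Real.mul_self_sqrt (Finset.sum_nonneg fun i _ => sq_nonneg (p i))] at h1
    refine le_of_mul_le_mul_left ?_ h0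
    linarith

end Sums

variable {X : Type*} [NormedAddCommGroup X]

theorem norm_sq_toLp_range {N : ℕ} (f : ℕ → X) :
    ‖(WithLp.toLp 2 fun j : Fin N => f j : FinSeq X N)‖ ^ 2 =
      ∑ j ∈ Finset.range N, ‖f j‖ ^ 2 := by
  rw [PiLp.norm_sq_eq_of_L2]
  exact Fin.sum_univ_eq_sum_range (fun j => ‖f j‖ ^ 2) N

/-- Summing a pointwise comparison of square sums over `ℤ`. -/
theorem sum_norm_sq_le_of_forall {ι : Type*} (I : Finset ι) {c : ℝ} {G H : ι → BiSeq X}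
    (h : ∀ k, c * ∑ i ∈ I, ‖H i k‖ ^ 2 ≤ ∑ i ∈ I, ‖G i k‖ ^ 2) :
    c * ∑ i ∈ I, ‖H i‖ ^ 2 ≤ ∑ i ∈ I, ‖G i‖ ^ 2 := by
  simp only [norm_sq_eq_tsum]
  rw [← Summable.tsum_finsetSum fun i _ => summable_norm_sq (G i),
    ← Summable.tsum_finsetSum fun i _ => summable_norm_sq (H i), ← tsum_mul_left]
  exact ((summable_sum fun i _ => summable_norm_sq (H i)).mul_left c).tsum_le_tsum h
    (summable_sum fun i _ => summable_norm_sq (G i))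

variable [NormedSpace ℂ X]

/-- Size `N + 1` and entries indexed by `ℕ` avoid arithmetic in `Fin`. The corner terms replace
exactly the neighbours that fall outside: `f (i - 1)` at `i = 0` and `f (i + 1)` at `i = N`. For `N
= 0` both replacements occur in the same row. -/
theorem cornerSection_apply {A : BiSeq X →L[ℂ] BiSeq X} (hA : IsTridiagonal A) {N : ℕ} (k : ℤ)
    (a c : X →L[ℂ] X) (f : ℕ → X) {i : ℕ} (hi : i ≤ N) :
    (cornerSection A (N + 1) k a c (WithLp.toLp 2 fun j : Fin (N + 1) => f j))
        ⟨i, Nat.lt_succ_of_le hi⟩ =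
      (if i = 0 then a (f N) else entry A (k + 1 + i) (k + i) (f (i - 1))) +
        entry A (k + 1 + i) (k + 1 + i) (f i) +
        (if i = N then c (f 0) else entry A (k + 1 + i) (k + 2 + i) (f (i + 1))) := by
  rw [cornerSection, matOp_apply]
  have h := Fin.sum_univ_eq_sum_range (fun j => entry A (k + 1 + i) (k + 1 + j) (f j) +
    (if i = 0 ∧ j + 1 = N + 1 then a else 0) (f j) +
    (if i + 1 = N + 1 ∧ j = 0 then c else 0) (f j)) (N + 1)
  refine Eq.trans h ?_
  rw [Finset.sum_add_distrib, Finset.sum_add_distrib, sum_range_eq_of_tridiagonal hi]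
  swap
  · intro j hj
    rw [hA _ _ (by rcases abs_cases ((k + 1 + i : ℤ) - (k + 1 + j)) with h | h <;> lia)]
    rfl
  have h1 : ∑ j ∈ Finset.range (N + 1), (if i = 0 ∧ j + 1 = N + 1 then a else 0) (f j) =
      if i = 0 then a (f N) else 0 := by
    rw [Finset.sum_eq_single N (fun j _ hj => by simp [hj]) (by simp)]
    split_ifs <;> simp_all
  have h2 : ∑ j ∈ Finset.range (N + 1), (if i + 1 = N + 1 ∧ j = 0 then c else 0) (f j) =
      if i = N then c (f 0) else 0 := by
    rw [Finset.sum_eq_single 0 (fun j _ hj => by simp [hj]) (by simp)]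
    split_ifs <;> simp_all
  rw [h1, h2]
  have e1 : i ≠ 0 → entry A (k + 1 + i) (k + 1 + (i - 1 : ℕ)) = entry A (k + 1 + i) (k + i) := by
    intro h
    congr 1
    push_cast [Nat.one_le_iff_ne_zero.2 h]
    ring
  have e2 : entry A (k + 1 + i) (k + 1 + (i + 1 : ℕ)) = entry A (k + 1 + i) (k + 2 + i) := by
    congr 1
    push_cast
    ring
  rw [e2]
  split_ifs with h3 h4 h4
  · abel
  · abel
  · rw [e1 h3]; abel
  · rw [e1 h3]; abel

end PiMethod

/-! ### Lower bounds pass from the sections to the operator -/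

namespace PiMethod

variable {X : Type*} [NormedAddCommGroup X] [NormedSpace ℂ X]

/-- Backward differences of the weights `u_0, …, u_N`, antiperiodically continued. -/
def backDiff (N : ℕ) (u : ℕ → ℝ) (i : ℕ) : ℝ := if i = 0 then u 0 + u N else u (i - 1) - u i

/-- Forward differences of the weights `u_0, …, u_N`, antiperiodically continued. -/
def fwdDiff (N : ℕ) (u : ℕ → ℝ) (i : ℕ) : ℝ := if i = N then u 0 + u N else u (i + 1) - u i

/-- The antiperiodic energy of the weights. -/
def weightEnergy (N : ℕ) (u : ℕ → ℝ) : ℝ :=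
  (u 0 + u N) ^ 2 + ∑ j ∈ Finset.range N, (u (j + 1) - u j) ^ 2

theorem sum_backDiff_sq (N : ℕ) (u : ℕ → ℝ) :
    ∑ i ∈ Finset.range (N + 1), |backDiff N u i| ^ 2 = weightEnergy N u := by
  simp only [sq_abs]
  rw [Finset.sum_range_succ', add_comm, weightEnergy]
  simp only [backDiff, if_true, Nat.add_eq_zero_iff, one_ne_zero, and_false, if_false,
    Nat.add_sub_cancel]
  congr 1
  exact Finset.sum_congr rfl fun j _ => by ring

theorem sum_fwdDiff_sq (N : ℕ) (u : ℕ → ℝ) :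
    ∑ i ∈ Finset.range (N + 1), |fwdDiff N u i| ^ 2 = weightEnergy N u := by
  simp only [sq_abs]
  rw [Finset.sum_range_succ, add_comm, weightEnergy, fwdDiff, if_pos rfl]
  congr 1
  exact Finset.sum_congr rfl fun j hj => by
    rw [fwdDiff, if_neg (Finset.mem_range.1 hj).ne]

/-- The two corner terms are unrelated apart from their norm bound, so the difference costs `p + q`
and not `|p - q|`. This makes the weight differences antiperiodic. -/
theorem norm_corner_le {a b : BiSeq X} {x : BiSeq X} {C p q : ℝ} (hp : 0 ≤ p) (hq : 0 ≤ q)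
    (ha : ‖a‖ ≤ C * ‖x‖) (hb : ‖b‖ ≤ C * ‖x‖) :
    ‖(p : ℂ) • a - (q : ℂ) • b‖ ≤ C * ‖x‖ * |p + q| := by
  refine (norm_sub_le _ _).trans ?_
  rw [norm_smul, norm_smul, Complex.norm_real, Complex.norm_real, Real.norm_of_nonneg hp,
    Real.norm_of_nonneg hq, abs_of_nonneg (add_nonneg hp hq)]
  nlinarith

theorem norm_real_smul_le {a x : BiSeq X} {C : ℝ} (p : ℝ) (ha : ‖a‖ ≤ C * ‖x‖) :
    ‖(p : ℂ) • a‖ ≤ C * ‖x‖ * |p| := by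
  rw [norm_smul, Complex.norm_real, Real.norm_eq_abs, mul_comm]
  exact mul_le_mul_of_nonneg_right ha (abs_nonneg _)

variable {A : BiSeq X →L[ℂ] BiSeq X} {𝔞 𝔠 : BddOpSeq X} {z : ℂ} {N : ℕ} {u : ℕ → ℝ} {μ : ℝ}

/-- Lower bounds of the shifted sections carry over to the operator, up to a penalty. -/
theorem lower_bound_of_sections (hA : IsTridiagonal A) (h𝔞 : ‖𝔞‖ ≤ ‖subdiag A‖)
    (h𝔠 : ‖𝔠‖ ≤ ‖superdiag A‖) (hu0 : 0 ≤ u 0) (huN : 0 ≤ u N) (hμ : 0 ≤ μ)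
    (h : ∀ k ξ, μ * ‖ξ‖ ≤
      ‖(genSection A 𝔞 𝔠 (N + 1) k - z • (1 : FinSeq X (N + 1) →L[ℂ] FinSeq X (N + 1))) ξ‖)
    (x : BiSeq X) :
    μ * √(∑ i ∈ Finset.range (N + 1), u i ^ 2) * ‖x‖ ≤
      √(∑ i ∈ Finset.range (N + 1), u i ^ 2) * ‖(A - z • (1 : BiSeq X →L[ℂ] BiSeq X)) x‖ +
        (‖subdiag A‖ + ‖superdiag A‖) * √(weightEnergy N u) * ‖x‖ := by
  set y := (A - z • (1 : BiSeq X →L[ℂ] BiSeq X)) x with hy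
  have hy' (m : ℤ) : y m = entry A m (m - 1) (x (m - 1)) + entry A m m (x m) +
      entry A m (m + 1) (x (m + 1)) - z • x m := by
    rw [← hA.apply_eq x m]
    rfl
  -- `P` and `Q` are the commutators of the weights with the sub- and superdiagonal. In rows `0` and
  -- `N` the true neighbour is subtracted and the corner term added. The free variable of these
  -- sequences is the position `k` of the section.
  let P : ℕ → BiSeq X := fun i => if i = 0 then
      (u N : ℂ) • mulSeq 𝔞 (shift (N + 1) x) - (u 0 : ℂ) • mulSeq (subdiag A) x
    else ((u (i - 1) - u i : ℝ) : ℂ) • shift i (mulSeq (subdiag A) x)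
  let Q : ℕ → BiSeq X := fun i => if i = N then
      (u 0 : ℂ) • mulSeq 𝔠 (shift 1 x) - (u N : ℂ) • shift (N + 2) (mulSeq (superdiag A) x)
    else ((u (i + 1) - u i : ℝ) : ℂ) • shift (i + 2) (mulSeq (superdiag A) x)
  let G : ℕ → BiSeq X := fun i => (u i : ℂ) • shift (i + 1) y + P i + Q i
  let H : ℕ → BiSeq X := fun i => (u i : ℂ) • shift (i + 1) x
  have hα := norm_mulSeq_apply_le (subdiag A) x
  have hγ := norm_mulSeq_apply_le (superdiag A) x
  have hP (i : ℕ) : ‖P i‖ ≤ ‖subdiag A‖ * ‖x‖ * |backDiff N u i| := by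
    by_cases hi : i = 0
    · simp only [P, backDiff, if_pos hi]
      rw [add_comm (u 0)]
      refine norm_corner_le huN hu0 ((norm_mulSeq_apply_le _ _).trans ?_) hα
      rw [norm_shift_apply]
      gcongr
    · simp only [P, backDiff, if_neg hi]
      exact norm_real_smul_le _ (by rwa [norm_shift_apply])
  have hQ (i : ℕ) : ‖Q i‖ ≤ ‖superdiag A‖ * ‖x‖ * |fwdDiff N u i| := by
    by_cases hi : i = N
    · simp only [Q, fwdDiff, if_pos hi]
      refine norm_corner_le hu0 huN ((norm_mulSeq_apply_le _ _).trans ?_)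
        (by rwa [norm_shift_apply])
      rw [norm_shift_apply]
      gcongr
    · simp only [Q, fwdDiff, if_neg hi]
      exact norm_real_smul_le _ (by rwa [norm_shift_apply])
  have hG (i : ℕ) : ‖G i‖ ≤ ‖y‖ * |u i| + ‖subdiag A‖ * ‖x‖ * |backDiff N u i| +
      ‖superdiag A‖ * ‖x‖ * |fwdDiff N u i| := by
    refine (norm_add₃_le).trans (add_le_add (add_le_add ?_ (hP i)) (hQ i))
    rw [norm_smul, norm_shift_apply, Complex.norm_real, Real.norm_eq_abs, mul_comm]
  -- The `k`-th section minus `z`, applied to the cut-off with entries `u_j x_{k+1+j}`, has `i`-th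
  -- entry `G i k`.
  have hrow (k : ℤ) (i : ℕ) (hi : i ≤ N) :
      ((genSection A 𝔞 𝔠 (N + 1) k - z • (1 : FinSeq X (N + 1) →L[ℂ] FinSeq X (N + 1)))
        (WithLp.toLp 2 fun j : Fin (N + 1) => H j k)) ⟨i, Nat.lt_succ_of_le hi⟩ = G i k := by
    have h1 := cornerSection_apply hA k (𝔞 k) (𝔠 k) (fun j => H j k) hi
    have h2 : ((genSection A 𝔞 𝔠 (N + 1) k - z • (1 : FinSeq X (N + 1) →L[ℂ] FinSeq X (N + 1)))
        (WithLp.toLp 2 fun j : Fin (N + 1) => H j k)) ⟨i, Nat.lt_succ_of_le hi⟩ =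
        (cornerSection A (N + 1) k (𝔞 k) (𝔠 k)
          (WithLp.toLp 2 fun j : Fin (N + 1) => H j k)) ⟨i, Nat.lt_succ_of_le hi⟩ - z • H i k :=
      rfl
    rw [h2, h1]
    have e1 : k + 1 + (i : ℤ) = k + (i + 1) := by ring
    have e2 : k + (i + 1 : ℤ) - 1 = k + i := by ring
    have e3 : k + (i + 1 : ℤ) + 1 = k + (i + 2) := by ring
    have e4 : k + 2 + (i : ℤ) = k + (i + 2) := by ring
    have e5 : k + (i : ℤ) + 1 = k + (i + 1) := by ring
    have e6 : k + ((i : ℤ) + 2) - 1 = k + (i + 1) := by ring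
    have e7 : k + ((i + 1 : ℕ) + 1 : ℤ) = k + (i + 2) := by push_cast; ring
    have hy1 := hy' (k + (i + 1))
    rw [e2, e3] at hy1
    have hleft : (if i = 0 then 𝔞 k (H N k) else
        entry A (k + 1 + i) (k + i) (H (i - 1) k)) =
        (u i : ℂ) • entry A (k + (i + 1)) (k + i) (x (k + i)) + P i k := by
      rw [e1]
      by_cases hi0 : i = 0
      · subst hi0
        have hPk : P 0 k = (u N : ℂ) • 𝔞 k (x (k + (N + 1))) -
          (u 0 : ℂ) • entry A (k + 1) k (x k) := rfl
        have hHk : H N k = (u N : ℂ) • x (k + (N + 1)) := rfl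
        rw [if_pos rfl, hPk, hHk, map_smul]
        simp only [Nat.cast_zero, zero_add, add_zero]
        module
      · obtain ⟨l, rfl⟩ := Nat.exists_eq_succ_of_ne_zero hi0
        have hPk : P (l + 1) k = ((u l - u (l + 1) : ℝ) : ℂ) •
          entry A (k + (l + 1 : ℕ) + 1) (k + (l + 1 : ℕ)) (x (k + (l + 1 : ℕ))) := by
          simp only [P, if_neg hi0]
          rfl
        have hHk : H l k = (u l : ℂ) • x (k + (l + 1 : ℕ)) := rfl
        rw [if_neg hi0, Nat.succ_eq_add_one, Nat.add_sub_cancel, hPk, hHk, map_smul, e5]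
        push_cast
        module
    have hright : (if i = N then 𝔠 k (H 0 k) else
        entry A (k + 1 + i) (k + 2 + i) (H (i + 1) k)) =
        (u i : ℂ) • entry A (k + (i + 1)) (k + (i + 2)) (x (k + (i + 2))) + Q i k := by
      rw [e1, e4]
      by_cases hi0 : i = N
      · subst hi0
        have hQk : Q i k = (u 0 : ℂ) • 𝔠 k (x (k + 1)) -
            (u i : ℂ) • entry A (k + (i + 2) - 1) (k + (i + 2)) (x (k + (i + 2))) := by
          simp only [Q, if_pos]
          rfl
        have hHk : H 0 k = (u 0 : ℂ) • x (k + 1) := rfl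
        rw [if_pos rfl, hQk, hHk, map_smul, e6]
        module
      · have hQk : Q i k = ((u (i + 1) - u i : ℝ) : ℂ) •
            entry A (k + (i + 2) - 1) (k + (i + 2)) (x (k + (i + 2))) := by
          simp only [Q, if_neg hi0]
          rfl
        have hHk : H (i + 1) k = (u (i + 1) : ℂ) • x (k + ((i + 1 : ℕ) + 1)) := rfl
        rw [if_neg hi0, hQk, hHk, map_smul, e6, e7]
        push_cast
        module
    rw [hleft, hright]
    have hGk : G i k = (u i : ℂ) • y (k + (i + 1)) + P i k + Q i k := rfl
    have hHk : H i k = (u i : ℂ) • x (k + (i + 1)) := rfl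
    rw [hGk, hHk, hy1, e1, map_smul]
    module
  -- Square the section bounds, sum over all `k` and exchange the two summations. Each `x_m` then
  -- meets every weight once, which produces `(∑ u_i²) ‖x‖²`.
  have hkey := sum_norm_sq_le_of_forall (Finset.range (N + 1)) (c := μ ^ 2) (G := G) (H := H)
    fun k => by
      have h1 := h k (WithLp.toLp 2 fun j : Fin (N + 1) => H j k)
      have h2 : ‖(genSection A 𝔞 𝔠 (N + 1) k - z • (1 : FinSeq X (N + 1) →L[ℂ] FinSeq X (N + 1)))
          (WithLp.toLp 2 fun j : Fin (N + 1) => H j k)‖ ^ 2 =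
          ∑ i ∈ Finset.range (N + 1), ‖G i k‖ ^ 2 := by
        rw [PiLp.norm_sq_eq_of_L2, ← Fin.sum_univ_eq_sum_range (fun j => ‖G j k‖ ^ 2) (N + 1)]
        exact Finset.sum_congr rfl fun i _ => by rw [← hrow k i (Nat.le_of_lt_succ i.2)]
      rw [← h2, ← norm_sq_toLp_range (fun j => H j k), ← mul_pow]
      exact pow_le_pow_left₀ (by positivity) h1 2
  have hH : ∑ i ∈ Finset.range (N + 1), ‖H i‖ ^ 2 =
      (∑ i ∈ Finset.range (N + 1), u i ^ 2) * ‖x‖ ^ 2 := by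
    rw [Finset.sum_mul]
    exact Finset.sum_congr rfl fun i _ => by
      simp only [H]
      rw [norm_smul, norm_shift_apply, Complex.norm_real, Real.norm_eq_abs, mul_pow, sq_abs]
  rw [hH] at hkey
  have hmink := sqrt_sum_sq_le (Finset.range (N + 1)) (norm_nonneg y)
    (mul_nonneg (norm_nonneg (subdiag A)) (norm_nonneg x))
    (mul_nonneg (norm_nonneg (superdiag A)) (norm_nonneg x)) (fun i _ => norm_nonneg (G i))
    fun i _ => hG i
  rw [sum_backDiff_sq, sum_fwdDiff_sq] at hmink
  simp only [sq_abs] at hmink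
  calc μ * √(∑ i ∈ Finset.range (N + 1), u i ^ 2) * ‖x‖
      = √(μ ^ 2 * ((∑ i ∈ Finset.range (N + 1), u i ^ 2) * ‖x‖ ^ 2)) := by
        rw [Real.sqrt_mul (sq_nonneg _), Real.sqrt_mul (Finset.sum_nonneg fun i _ => sq_nonneg _),
          Real.sqrt_sq hμ, Real.sqrt_sq (norm_nonneg _), mul_assoc]
    _ ≤ √(∑ i ∈ Finset.range (N + 1), ‖G i‖ ^ 2) := Real.sqrt_le_sqrt hkey
    _ ≤ _ := hmink.trans_eq (by ring)

end PiMethod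

/-! ### Approximate solutions pasted from the sections -/

namespace PiMethod

section SummationByParts

variable {M : Type*} [AddCommGroup M] [Module ℂ M]

/-- Summation by parts moves the index shift from the vectors to the weights; the term `a'` stands
for the missing `a (-1)`. -/
theorem sum_smul_sub_sum_backward (N : ℕ) (u : ℕ → ℝ) (a' : M) (a : ℕ → M) :
    ∑ i ∈ Finset.range (N + 1), (u i : ℂ) • (if i = 0 then a' else a (i - 1)) -
        ∑ i ∈ Finset.range (N + 1), (u i : ℂ) • a i =
      ∑ i ∈ Finset.range (N + 1), if i = N then (u 0 : ℂ) • a' - (u N : ℂ) • a N else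
        ((u (i + 1) - u i : ℝ) : ℂ) • a i := by
  rw [Finset.sum_range_succ', Finset.sum_range_succ (n := N), Finset.sum_range_succ (n := N)]
  rw [Finset.sum_congr rfl (g := fun i => ((u (i + 1) - u i : ℝ) : ℂ) • a i) (s₁ := Finset.range N)
    (f := fun i => if i = N then _ else _) fun i hi => if_neg (Finset.mem_range.1 hi).ne]
  simp only [if_pos, Nat.add_eq_zero_iff, one_ne_zero, and_false, if_false, Nat.add_sub_cancel,
    Complex.ofReal_sub, sub_smul, Finset.sum_sub_distrib]
  abel

theorem sum_smul_sub_sum_forward (N : ℕ) (u : ℕ → ℝ) (a' : M) (a : ℕ → M) :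
    ∑ i ∈ Finset.range (N + 1), (u i : ℂ) • (if i = N then a' else a (i + 1)) -
        ∑ i ∈ Finset.range (N + 1), (u i : ℂ) • a i =
      ∑ i ∈ Finset.range (N + 1), if i = 0 then (u N : ℂ) • a' - (u 0 : ℂ) • a 0 else
        ((u (i - 1) - u i : ℝ) : ℂ) • a i := by
  rw [Finset.sum_range_succ, Finset.sum_range_succ' (n := N), Finset.sum_range_succ' (n := N)]
  rw [Finset.sum_congr rfl (g := fun i => (u i : ℂ) • a (i + 1)) (s₁ := Finset.range N)
    (f := fun i => (u i : ℂ) • if i = N then _ else _)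
    fun i hi => by rw [if_neg (Finset.mem_range.1 hi).ne]]
  simp only [if_pos, Nat.add_eq_zero_iff, one_ne_zero, and_false, if_false, Nat.add_sub_cancel,
    Complex.ofReal_sub, sub_smul, Finset.sum_sub_distrib]
  abel

end SummationByParts

variable {X : Type*} [NormedAddCommGroup X] {N : ℕ} {μ : ℝ}

/-- Solutions of the section equations with uniformly bounded norms can be collected into elements
of `ℓ²(ℤ, X)`. -/
theorem exists_biSeq_of_forall_sum_le (H : ℕ → BiSeq X) (hμ : 0 < μ) (ζ : ℤ → FinSeq X N)
    (hζ : ∀ k, μ ^ 2 * ‖ζ k‖ ^ 2 ≤ ∑ i ∈ Finset.range N, ‖H i k‖ ^ 2) :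
    ∃ Z : ℕ → BiSeq X, (∀ k, ζ k = WithLp.toLp 2 fun j : Fin N => Z j k) ∧
      μ ^ 2 * ∑ i ∈ Finset.range N, ‖Z i‖ ^ 2 ≤ ∑ i ∈ Finset.range N, ‖H i‖ ^ 2 := by
  have hmem (i : ℕ) : Memℓp (fun k => if h : i < N then ζ k ⟨i, h⟩ else 0) 2 := by
    -- The default value `0` for `i ≥ N` is never seen by the sums over `Finset.range N`.
    refine memlp_two_of_summable (.of_nonneg_of_le (fun k => by positivity) (fun k => ?_)
      ((summable_sum (s := Finset.range N) fun i _ => summable_norm_sq (H i)).mul_left (μ ^ 2)⁻¹))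
    have h1 : ‖ζ k‖ ^ 2 ≤ (μ ^ 2)⁻¹ * ∑ i ∈ Finset.range N, ‖H i k‖ ^ 2 := by
      rw [inv_mul_eq_div, le_div_iff₀ (by positivity)]
      linarith [hζ k]
    refine le_trans ?_ h1
    split_ifs with h
    · exact pow_le_pow_left₀ (norm_nonneg _) (PiLp.norm_apply_le _ _) 2
    · simp
  refine ⟨fun i => ⟨_, hmem i⟩, fun k => ?_, ?_⟩
  · ext j
    simp
  · refine sum_norm_sq_le_of_forall _ fun k => ?_
    refine le_trans (le_of_eq ?_) (hζ k)
    rw [PiLp.norm_sq_eq_of_L2, ← Fin.sum_univ_eq_sum_range (fun i => ‖_‖ ^ 2)]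
    congr 1
    exact Finset.sum_congr rfl fun j _ => by simp

variable [NormedSpace ℂ X]
variable {A : BiSeq X →L[ℂ] BiSeq X} {𝔞 𝔠 : BddOpSeq X} {z : ℂ} {u : ℕ → ℝ}

/-- If the shifted sections are invertible with a uniform lower bound `μ`, the operator equation
can be solved approximately. -/
theorem approx_surjective_of_sections (hA : IsTridiagonal A) (h𝔞 : ‖𝔞‖ ≤ ‖subdiag A‖)
    (h𝔠 : ‖𝔠‖ ≤ ‖superdiag A‖) (hu0 : 0 ≤ u 0) (huN : 0 ≤ u N) (hμ : 0 < μ)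
    (h : ∀ k ξ, μ * ‖ξ‖ ≤
      ‖(genSection A 𝔞 𝔠 (N + 1) k - z • (1 : FinSeq X (N + 1) →L[ℂ] FinSeq X (N + 1))) ξ‖)
    (hsurj : ∀ k, Function.Surjective
      (genSection A 𝔞 𝔠 (N + 1) k - z • (1 : FinSeq X (N + 1) →L[ℂ] FinSeq X (N + 1))))
    (y : BiSeq X) :
    ∃ x, μ * ‖((∑ i ∈ Finset.range (N + 1), u i ^ 2 : ℝ) : ℂ) • y -
        (A - z • (1 : BiSeq X →L[ℂ] BiSeq X)) x‖ ≤
      (‖subdiag A‖ + ‖superdiag A‖) * √(weightEnergy N u) *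
        (√(∑ i ∈ Finset.range (N + 1), u i ^ 2) * ‖y‖) := by
  let H : ℕ → BiSeq X := fun i => (u i : ℂ) • shift (i + 1) y
  choose ζ hζ using fun k => hsurj k (WithLp.toLp 2 fun j : Fin (N + 1) => H j k)
  obtain ⟨Z, hZ, hZH⟩ := exists_biSeq_of_forall_sum_le H hμ ζ fun k => by
    rw [← norm_sq_toLp_range (fun j => H j k), ← mul_pow, ← hζ k]
    exact pow_le_pow_left₀ (by positivity) (h k _) 2
  have hH : ∑ i ∈ Finset.range (N + 1), ‖H i‖ ^ 2 =
      (∑ i ∈ Finset.range (N + 1), u i ^ 2) * ‖y‖ ^ 2 := by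
    rw [Finset.sum_mul]
    exact Finset.sum_congr rfl fun i _ => by
      simp only [H]
      rw [norm_smul, norm_shift_apply, Complex.norm_real, Real.norm_eq_abs, mul_pow, sq_abs]
  rw [hH] at hZH
  -- The error terms left by summation by parts. Compared with the lower bound, forward and backward
  -- differences trade places; their square sums agree.
  let P : ℕ → BiSeq X := fun i => if i = N then
      (u 0 : ℂ) • shift (-1) (mulSeq 𝔞 (Z N)) -
        (u N : ℂ) • shift (-1) (mulSeq (subdiag A) (shift (-(N + 1)) (Z N)))
    else ((u (i + 1) - u i : ℝ) : ℂ) • shift (-1) (mulSeq (subdiag A) (shift (-(i + 1)) (Z i)))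
  let Q : ℕ → BiSeq X := fun i => if i = 0 then
      (u N : ℂ) • shift (-(N + 1)) (mulSeq 𝔠 (Z 0)) -
        (u 0 : ℂ) • shift 1 (mulSeq (superdiag A) (shift (-((0 : ℕ) + 1)) (Z 0)))
    else ((u (i - 1) - u i : ℝ) : ℂ) • shift 1 (mulSeq (superdiag A) (shift (-(i + 1)) (Z i)))
  have hmul (b b' : BddOpSeq X) (hb : ‖b‖ ≤ ‖b'‖) (s t : ℤ) (w : BiSeq X) :
      ‖shift s (mulSeq b (shift t w))‖ ≤ ‖b'‖ * ‖w‖ := by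
    rw [norm_shift_apply]
    refine (norm_mulSeq_apply_le _ _).trans ?_
    rw [norm_shift_apply]
    gcongr
  have hmul' (b b' : BddOpSeq X) (hb : ‖b‖ ≤ ‖b'‖) (s : ℤ) (w : BiSeq X) :
      ‖shift s (mulSeq b w)‖ ≤ ‖b'‖ * ‖w‖ := by
    rw [norm_shift_apply]
    refine (norm_mulSeq_apply_le _ _).trans ?_
    gcongr
  have hP (i : ℕ) : ‖P i‖ ≤ ‖subdiag A‖ * ‖Z i‖ * |fwdDiff N u i| := by
    by_cases hi : i = N
    · simp only [P, fwdDiff, if_pos hi]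
      rw [hi]
      exact norm_corner_le hu0 huN (hmul' _ _ h𝔞 _ _) (hmul _ _ le_rfl _ _ _)
    · simp only [P, fwdDiff, if_neg hi]
      exact norm_real_smul_le _ (hmul _ _ le_rfl _ _ _)
  have hQ (i : ℕ) : ‖Q i‖ ≤ ‖superdiag A‖ * ‖Z i‖ * |backDiff N u i| := by
    by_cases hi : i = 0
    · simp only [Q, backDiff, if_pos hi]
      rw [hi, add_comm (u 0)]
      exact norm_corner_le huN hu0 (hmul' _ _ h𝔠 _ _) (hmul _ _ le_rfl _ _ _)
    · simp only [Q, backDiff, if_neg hi]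
      exact norm_real_smul_le _ (hmul _ _ le_rfl _ _ _)
  -- Position `l` is row `i` of the section with `k = l - (i + 1)`; the values proposed there by the
  -- `N + 1` overlapping sections are added with weights `u_i`.
  let x : BiSeq X := ∑ i ∈ Finset.range (N + 1), (u i : ℂ) • shift (-(i + 1)) (Z i)
  have hid : ((∑ i ∈ Finset.range (N + 1), u i ^ 2 : ℝ) : ℂ) • y -
      (A - z • (1 : BiSeq X →L[ℂ] BiSeq X)) x = ∑ i ∈ Finset.range (N + 1), (P i + Q i) := by
    ext m
    let a : ℕ → X := fun i => entry A m (m - 1) (Z i (m - 1 - (i + 1)))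
    let b : ℕ → X := fun i => entry A m m (Z i (m - (i + 1))) - z • Z i (m - (i + 1))
    let c : ℕ → X := fun i => entry A m (m + 1) (Z i (m + 1 - (i + 1)))
    let a' : X := 𝔞 (m - 1) (Z N (m - 1))
    let c' : X := 𝔠 (m - (N + 1)) (Z 0 (m - (N + 1)))
    have hx (l : ℤ) : x l = ∑ i ∈ Finset.range (N + 1), (u i : ℂ) • Z i (l - (i + 1)) := by
      simp only [x]
      rw [lp.coeFn_sum, Finset.sum_apply]
      rfl
    have hAx : ((A - z • (1 : BiSeq X →L[ℂ] BiSeq X)) x : BiSeq X) m =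
        ∑ i ∈ Finset.range (N + 1), (u i : ℂ) • a i +
          ∑ i ∈ Finset.range (N + 1), (u i : ℂ) • b i +
          ∑ i ∈ Finset.range (N + 1), (u i : ℂ) • c i := by
      have h1 : ((A - z • (1 : BiSeq X →L[ℂ] BiSeq X)) x : BiSeq X) m =
        (A x : BiSeq X) m - z • x m := rfl
      rw [h1, hA.apply_eq, hx, hx, hx]
      simp only [map_sum, map_smul, Finset.smul_sum, a, b, c, smul_sub, Finset.sum_sub_distrib,
        smul_comm z]
      abel
    -- Row `i` of the section equation with `k = m - (i + 1)`. Its neighbours come from the same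
    -- section, hence the indices `i - 1` and `i + 1`, whereas row `m` of `(A - z) x` pairs `u_i`
    -- with `a i` and `c i`.
    have hrow (i : ℕ) (hi : i ∈ Finset.range (N + 1)) :
        (if i = 0 then a' else a (i - 1)) + b i + (if i = N then c' else c (i + 1)) =
          (u i : ℂ) • y m := by
      have hi' : i ≤ N := Nat.le_of_lt_succ (Finset.mem_range.1 hi)
      have h1 := cornerSection_apply hA (m - (i + 1)) (𝔞 (m - (i + 1))) (𝔠 (m - (i + 1)))
        (fun j => Z j (m - (i + 1))) hi'
      have h2 := congrArg (fun w : FinSeq X (N + 1) => w ⟨i, Nat.lt_succ_of_le hi'⟩)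
        (hζ (m - (i + 1)))
      rw [hZ] at h2
      have h3 : (cornerSection A (N + 1) (m - (i + 1)) (𝔞 (m - (i + 1))) (𝔠 (m - (i + 1)))
          (WithLp.toLp 2 fun j : Fin (N + 1) => Z j (m - (i + 1)))) ⟨i, Nat.lt_succ_of_le hi'⟩ -
          z • Z i (m - (i + 1)) = (u i : ℂ) • y (m - (i + 1) + (i + 1)) := h2
      rw [h1, sub_add_cancel] at h3
      rw [← h3]
      have e1 : m - (i + 1 : ℤ) + 1 + i = m := by ring
      have e2 : m - (i + 1 : ℤ) + i = m - 1 := by ring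
      have e3 : m - (i + 1 : ℤ) + 2 + i = m + 1 := by ring
      rw [e1, e2, e3]
      have ha : (if i = 0 then a' else a (i - 1)) = if i = 0 then
          𝔞 (m - (i + 1)) (Z N (m - (i + 1))) else
          entry A m (m - 1) (Z (i - 1) (m - (i + 1))) := by
        rcases i with _ | l
        · simp [a']
        · simp only [a, if_neg (Nat.succ_ne_zero l), Nat.add_sub_cancel]
          congr 2
          push_cast
          ring_nf
      have hc : (if i = N then c' else c (i + 1)) = if i = N then
          𝔠 (m - (i + 1)) (Z 0 (m - (i + 1))) else
          entry A m (m + 1) (Z (i + 1) (m - (i + 1))) := by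
        split_ifs with hiN
        · rw [hiN]
        · simp only [c]
          congr 2
          push_cast
          ring_nf
      rw [ha, hc]
      simp only [b]
      abel
    have hP' (i : ℕ) : P i m = if i = N then (u 0 : ℂ) • a' - (u N : ℂ) • a N else
        ((u (i + 1) - u i : ℝ) : ℂ) • a i := by
      have e : entry A (m - 1 + 1) (m - 1) = entry A m (m - 1) := by rw [sub_add_cancel]
      simp only [P, a, a', ← e]
      split_ifs <;> rfl
    have hQ' (i : ℕ) : Q i m = if i = 0 then (u N : ℂ) • c' - (u 0 : ℂ) • c 0 else
        ((u (i - 1) - u i : ℝ) : ℂ) • c i := by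
      have e : entry A (m + 1 - 1) (m + 1) = entry A m (m + 1) := by rw [add_sub_cancel_right]
      simp only [Q, c, c', ← e]
      split_ifs <;> rfl
    have hy : (((∑ i ∈ Finset.range (N + 1), u i ^ 2 : ℝ) : ℂ) • y) m =
        ∑ i ∈ Finset.range (N + 1), (u i : ℂ) • (if i = 0 then a' else a (i - 1)) +
          ∑ i ∈ Finset.range (N + 1), (u i : ℂ) • b i +
          ∑ i ∈ Finset.range (N + 1), (u i : ℂ) • (if i = N then c' else c (i + 1)) := by
      have h1 : (((∑ i ∈ Finset.range (N + 1), u i ^ 2 : ℝ) : ℂ) • y) m =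
        ((∑ i ∈ Finset.range (N + 1), u i ^ 2 : ℝ) : ℂ) • y m := rfl
      rw [h1, ← Finset.sum_add_distrib, ← Finset.sum_add_distrib, Complex.ofReal_sum,
        Finset.sum_smul]
      refine Finset.sum_congr rfl fun i hi => ?_
      rw [← smul_add, ← smul_add, hrow i hi, smul_smul, Complex.ofReal_pow, sq]
    have hPQ : (∑ i ∈ Finset.range (N + 1), (P i + Q i) : BiSeq X) m =
        ∑ i ∈ Finset.range (N + 1), P i m + ∑ i ∈ Finset.range (N + 1), Q i m := by
      rw [lp.coeFn_sum, Finset.sum_apply, ← Finset.sum_add_distrib]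
      rfl
    rw [hPQ, Finset.sum_congr rfl fun i _ => hP' i, Finset.sum_congr rfl fun i _ => hQ' i,
      ← sum_smul_sub_sum_backward, ← sum_smul_sub_sum_forward, lp.coeFn_sub, Pi.sub_apply, hAx, hy]
    abel
  refine ⟨x, ?_⟩
  rw [hid]
  have hZ2 : μ * √(∑ i ∈ Finset.range (N + 1), ‖Z i‖ ^ 2) ≤
      √(∑ i ∈ Finset.range (N + 1), u i ^ 2) * ‖y‖ := by
    have := Real.sqrt_le_sqrt hZH
    rwa [Real.sqrt_mul (sq_nonneg _), Real.sqrt_mul (Finset.sum_nonneg fun i _ => sq_nonneg _),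
      Real.sqrt_sq hμ.le, Real.sqrt_sq (norm_nonneg _)] at this
  have h1 := Real.sum_mul_le_sqrt_mul_sqrt (Finset.range (N + 1)) (fun i => |fwdDiff N u i|)
    fun i => ‖Z i‖
  have h2 := Real.sum_mul_le_sqrt_mul_sqrt (Finset.range (N + 1)) (fun i => |backDiff N u i|)
    fun i => ‖Z i‖
  rw [sum_fwdDiff_sq] at h1
  rw [sum_backDiff_sq] at h2
  have h3 : ‖∑ i ∈ Finset.range (N + 1), (P i + Q i)‖ ≤
      ‖subdiag A‖ * ∑ i ∈ Finset.range (N + 1), |fwdDiff N u i| * ‖Z i‖ +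
        ‖superdiag A‖ * ∑ i ∈ Finset.range (N + 1), |backDiff N u i| * ‖Z i‖ := by
    rw [Finset.mul_sum, Finset.mul_sum, ← Finset.sum_add_distrib]
    refine norm_sum_le_of_le _ fun i _ => (norm_add_le _ _).trans (add_le_add ?_ ?_)
    · linarith [hP i]
    · linarith [hQ i]
  calc _ ≤ μ * ((‖subdiag A‖ + ‖superdiag A‖) * (√(weightEnergy N u) *
        √(∑ i ∈ Finset.range (N + 1), ‖Z i‖ ^ 2))) := by
        gcongr
        refine h3.trans ?_
        rw [add_mul]
        gcongr
    _ = (‖subdiag A‖ + ‖superdiag A‖) * √(weightEnergy N u) *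
        (μ * √(∑ i ∈ Finset.range (N + 1), ‖Z i‖ ^ 2)) := by ring
    _ ≤ _ := by gcongr

end PiMethod

/-! ### Penalty terms, optimal weights and the open inclusion -/

namespace PiMethod

section Weights

theorem sum_Icc_one_succ_eq {M : Type*} [AddCommMonoid M] (N : ℕ) (f : ℕ → M) :
    ∑ j ∈ Finset.Icc 1 (N + 1), f j = ∑ i ∈ Finset.range (N + 1), f (i + 1) := by
  rw [show Finset.Icc 1 (N + 1) = Finset.Ico 1 (N + 2) by ext; simp; lia,
    Finset.sum_Ico_eq_sum_range]
  exact Finset.sum_congr rfl fun i _ => by rw [add_comm]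

theorem weightEnergy_succ (N : ℕ) (w : ℕ → ℝ) :
    weightEnergy N (fun i => w (i + 1)) =
      (w 1 + w (N + 1)) ^ 2 + ∑ j ∈ Finset.Ico 1 (N + 1), (w (j + 1) - w j) ^ 2 := by
  rw [weightEnergy, Finset.sum_Ico_eq_sum_range]
  congr 1
  exact Finset.sum_congr rfl fun i _ => by rw [add_comm 1 i]

/-- The optimal weights have energy `4 sin² (π / (2n))` times their square sum. -/
theorem weightEnergy_sin (N : ℕ) :
    weightEnergy N (fun i => Real.sin ((2 * i + 1) * (Real.pi / (2 * (N + 1 : ℕ))))) =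
      (2 * Real.sin (Real.pi / (2 * (N + 1 : ℕ)))) ^ 2 * ∑ i ∈ Finset.range (N + 1),
        Real.sin ((2 * i + 1) * (Real.pi / (2 * (N + 1 : ℕ)))) ^ 2 := by
  set θ := Real.pi / (2 * (N + 1 : ℕ)) with hθ
  -- Indexing by `ℤ` gives access to `v (-1)`. The sequence changes sign under translation by `N +
  -- 1`, so `(u 0 + u N)²` is one more squared difference.
  set v : ℤ → ℝ := fun i => Real.sin ((2 * i + 1) * θ) with hv
  have hper : v ((N + 1 : ℕ)) = -v 0 := by
    have h1 : (2 * ((N + 1 : ℕ) : ℝ) + 1) * θ = 1 * θ + Real.pi := by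
      rw [hθ]
      field_simp
      ring
    simp only [hv, Int.cast_natCast, Int.cast_zero, h1, Real.sin_add_pi]
    norm_num
  have hper' : v (N : ℕ) = -v (-1) := by
    have h1 : (2 * (N : ℝ) + 1) * θ = Real.pi - θ := by
      rw [hθ]
      push_cast
      field_simp
      ring
    simp only [hv, Int.cast_natCast, h1, Real.sin_pi_sub]
    push_cast
    rw [show (2 * (-1) + 1) * θ = -θ by ring, Real.sin_neg, neg_neg]
  have hrec (i : ℤ) : v (i + 1) + v (i - 1) = 2 * (1 - 2 * Real.sin θ ^ 2) * v i := by
    have h1 := Real.sin_add ((2 * i + 1) * θ) (2 * θ)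
    have h2 := Real.sin_sub ((2 * i + 1) * θ) (2 * θ)
    have h3 : v (i + 1) = Real.sin ((2 * i + 1) * θ + 2 * θ) := by
      simp only [hv]; push_cast; ring_nf
    have h4 : v (i - 1) = Real.sin ((2 * i + 1) * θ - 2 * θ) := by
      simp only [hv]; push_cast; ring_nf
    rw [h3, h4, h1, h2, Real.cos_two_mul, Real.cos_sq']
    ring
  -- By the recurrence the summand is the increment of `v_i² - v_i v_{i-1}`, and this expression
  -- takes equal values at `0` and `N + 1` because it is quadratic in an antiperiodic sequence.
  have htel : ∑ i ∈ Finset.range (N + 1),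
      ((v ((i : ℕ) + 1) - v (i : ℕ)) ^ 2 - (2 * Real.sin θ) ^ 2 * v (i : ℕ) ^ 2) = 0 := by
    have h1 := Finset.sum_range_sub
      (fun i : ℕ => v (i : ℕ) ^ 2 - v (i : ℕ) * v ((i : ℕ) - 1)) (N + 1)
    have h2 : (((N + 1 : ℕ) : ℤ) - 1) = (N : ℕ) := by push_cast; ring
    rw [hper, h2, hper', Nat.cast_zero, zero_sub] at h1
    rw [show (0 : ℝ) = (-v 0) ^ 2 - -v 0 * -v (-1) - (v 0 ^ 2 - v 0 * v (-1)) by ring, ← h1]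
    refine Finset.sum_congr rfl fun i _ => ?_
    push_cast
    rw [add_sub_cancel_right]
    have h3 := hrec i
    linear_combination (-v (i : ℕ)) * h3
  rw [Finset.sum_sub_distrib, ← Finset.mul_sum, sub_eq_zero, Finset.sum_range_succ] at htel
  have hN : ((N : ℕ) : ℤ) + 1 = (N + 1 : ℕ) := by push_cast; ring
  rw [hN, hper] at htel
  rw [weightEnergy]
  simp only [hv] at htel
  push_cast at htel ⊢
  rw [← htel]
  ring_nf

end Weights

variable {X : Type*} [NormedAddCommGroup X] [NormedSpace ℂ X] {A : BiSeq X →L[ℂ] BiSeq X}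

theorem weightedPenalty_nonneg (A : BiSeq X →L[ℂ] BiSeq X) (n : ℕ) (w : ℕ → ℝ) :
    0 ≤ weightedPenalty A n w := by
  unfold weightedPenalty
  positivity

theorem sum_sq_pos_of_exists {n : ℕ} {w : ℕ → ℝ} (hw : ∃ j ∈ Finset.Icc 1 n, w j ≠ 0) :
    0 < ∑ j ∈ Finset.Icc 1 n, w j ^ 2 := by
  obtain ⟨j, hj, h⟩ := hw
  exact Finset.sum_pos' (fun _ _ => sq_nonneg _) ⟨j, hj, by positivity⟩

/-- If the energy vanished, the weights would be constant with `w 1 = -w n`, hence zero. The strict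
sign is what admits `ε = 0` in the closed inclusion when `X` is infinite-dimensional. -/
theorem weightedPenalty_pos {n : ℕ} (hn : 1 ≤ n) {w : ℕ → ℝ}
    (hw : ∃ j ∈ Finset.Icc 1 n, w j ≠ 0) (hA : 0 < ‖subdiag A‖ + ‖superdiag A‖) :
    0 < weightedPenalty A n w := by
  refine mul_pos hA (Real.sqrt_pos.2 (div_pos ?_ (sum_sq_pos_of_exists hw)))
  have h0 : 0 ≤ ∑ j ∈ Finset.Ico 1 n, (w (j + 1) - w j) ^ 2 :=
    Finset.sum_nonneg fun _ _ => sq_nonneg _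
  by_contra hT
  have h1 : (w 1 + w n) ^ 2 = 0 := by nlinarith [sq_nonneg (w 1 + w n)]
  have h2 : ∑ j ∈ Finset.Ico 1 n, (w (j + 1) - w j) ^ 2 = 0 := by
    nlinarith [sq_nonneg (w 1 + w n)]
  have h3 : ∀ j, 1 ≤ j → j ≤ n → w j = w 1 := by
    intro j hj
    induction j, hj using Nat.le_induction with
    | base => simp
    | succ j hj ih =>
      intro hjn
      have := (Finset.sum_eq_zero_iff_of_nonneg fun _ _ => sq_nonneg _).1 h2 j
        (Finset.mem_Ico.2 ⟨hj, hjn⟩)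
      linarith [ih (by lia), pow_eq_zero_iff two_ne_zero |>.1 this]
  obtain ⟨j, hj, hj0⟩ := hw
  rw [Finset.mem_Icc] at hj
  have := pow_eq_zero_iff two_ne_zero |>.1 h1
  rw [h3 n hn le_rfl] at this
  exact hj0 (by linarith [h3 j hj.1 hj.2])

/-- The open pseudospectrum inclusion for general weights. -/
theorem openPseudospectrum_subset_genOpenSet [CompleteSpace X] (hA : IsTridiagonal A) {n : ℕ}
    (hn : 1 ≤ n) {𝔞 𝔠 : BddOpSeq X} (h𝔞 : ‖𝔞‖ ≤ ‖subdiag A‖) (h𝔠 : ‖𝔠‖ ≤ ‖superdiag A‖)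
    {w : ℕ → ℝ} (hw : ∀ j ∈ Finset.Icc 1 n, 0 ≤ w j) (hw0 : ∃ j ∈ Finset.Icc 1 n, w j ≠ 0)
    {ε : ℝ} (hε : 0 < ε) :
    openPseudospectrum ε A ⊆ genOpenSet A 𝔞 𝔠 n (ε + weightedPenalty A n w) := by
  intro z
  contrapose
  intro hz
  have hp := weightedPenalty_nonneg A n w
  have hμ : 0 < ε + weightedPenalty A n w := by linarith
  have hS := sum_sq_pos_of_exists hw0
  obtain ⟨N, rfl⟩ := Nat.exists_eq_succ_of_ne_zero (by lia : n ≠ 0)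
  rw [Nat.succ_eq_add_one] at *
  have hsec (k : ℤ) := (notMem_openPseudospectrum_iff hμ).1
    fun h => hz (Set.mem_iUnion.2 ⟨k, h⟩)
  have hpen : weightedPenalty A (N + 1) w * √(∑ i ∈ Finset.range (N + 1), w (i + 1) ^ 2) =
      (‖subdiag A‖ + ‖superdiag A‖) * √(weightEnergy N fun i => w (i + 1)) := by
    rw [← sum_Icc_one_succ_eq N fun j => w j ^ 2, weightEnergy_succ, weightedPenalty,
      Real.sqrt_div' _ hS.le, mul_assoc, div_mul_cancel₀]
    exact (Real.sqrt_pos.2 hS).ne'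
  set p := weightedPenalty A (N + 1) w
  rw [sum_Icc_one_succ_eq N fun j => w j ^ 2] at hS
  have hS' := Real.sqrt_pos.2 hS
  have hbelow (x : BiSeq X) : ε * ‖x‖ ≤ ‖(A - z • (1 : BiSeq X →L[ℂ] BiSeq X)) x‖ := by
    have h1 := lower_bound_of_sections hA h𝔞 h𝔠 (u := fun i => w (i + 1)) (hw 1 (by simp))
      (hw (N + 1) (by simp)) hμ.le (fun k => (hsec k).2) x
    rw [← hpen] at h1
    refine le_of_mul_le_mul_left ?_ hS'
    linarith
  rw [notMem_openPseudospectrum_iff hε]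
  -- The pasted vector solves for `S y` with error at most `p S ‖y‖ / (ε + p)`; dividing by `S`
  -- gives the relative error `q`.
  refine ⟨isUnit_of_approx_surjective _ hε (q := p / (ε + p))
    ((div_lt_one hμ).2 (by linarith)) hbelow fun y => ?_, hbelow⟩
  obtain ⟨x, hx⟩ := approx_surjective_of_sections hA h𝔞 h𝔠 (u := fun i => w (i + 1))
    (hw 1 (by simp)) (hw (N + 1) (by simp)) hμ (fun k => (hsec k).2)
    (fun k => (ContinuousLinearMap.isUnit_iff_bijective.1 (hsec k).1).2) y
  rw [← hpen] at hx
  set S := ∑ i ∈ Finset.range (N + 1), w (i + 1) ^ 2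
  have hS0 : (S : ℂ) ≠ 0 := by exact_mod_cast hS.ne'
  refine ⟨(S : ℂ)⁻¹ • x, ?_⟩
  have h1 : (S : ℂ) • y - (A - z • (1 : BiSeq X →L[ℂ] BiSeq X)) x =
      (S : ℂ) • (y - (A - z • (1 : BiSeq X →L[ℂ] BiSeq X)) ((S : ℂ)⁻¹ • x)) := by
    rw [smul_sub, map_smul, smul_inv_smul₀ hS0]
  rw [h1, norm_smul, Complex.norm_real, Real.norm_of_nonneg hS.le] at hx
  rw [div_mul_eq_mul_div, le_div_iff₀ hμ]
  refine le_of_mul_le_mul_left ?_ hS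
  calc _ = (ε + p) * (S * ‖y - (A - z • (1 : BiSeq X →L[ℂ] BiSeq X)) ((S : ℂ)⁻¹ • x)‖) := by ring
    _ ≤ p * √S * (√S * ‖y‖) := hx
    _ = (√S * √S) * (p * ‖y‖) := by ring
    _ = S * (p * ‖y‖) := by rw [Real.mul_self_sqrt hS.le]

/-- The optimal weights `w_j = sin ((2j - 1) π / (2n))`. -/
def optimalWeight (n : ℕ) (j : ℕ) : ℝ := Real.sin ((2 * j - 1) * (Real.pi / (2 * n)))

theorem optimalWeight_pos {n j : ℕ} (hj : j ∈ Finset.Icc 1 n) : 0 < optimalWeight n j := by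
  rw [Finset.mem_Icc] at hj
  have h1 : (1 : ℝ) ≤ j := by exact_mod_cast hj.1
  have h2 : (j : ℝ) ≤ n := by exact_mod_cast hj.2
  have hn : (0 : ℝ) < n := by linarith
  refine Real.sin_pos_of_pos_of_lt_pi (mul_pos (by linarith) (by positivity)) ?_
  rw [mul_div_assoc', div_lt_iff₀ (by positivity)]
  nlinarith [Real.pi_pos]

theorem weightedPenalty_optimalWeight (A : BiSeq X →L[ℂ] BiSeq X) {n : ℕ} (hn : 1 ≤ n) :
    weightedPenalty A n (optimalWeight n) = penalty A n := by
  have hS := sum_sq_pos_of_exists ⟨1, by simpa using hn, (optimalWeight_pos (n := n) (j := 1)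
    (by simpa using hn)).ne'⟩
  have hsin : 0 ≤ Real.sin (Real.pi / (2 * n)) := by
    have h := optimalWeight_pos (n := n) (j := 1) (by simpa using hn)
    rw [optimalWeight] at h
    norm_num at h
    exact h.le
  obtain ⟨N, rfl⟩ := Nat.exists_eq_succ_of_ne_zero (by lia : n ≠ 0)
  rw [Nat.succ_eq_add_one] at *
  have h := weightEnergy_sin N
  have hu (i : ℕ) : Real.sin ((2 * i + 1) * (Real.pi / (2 * (N + 1 : ℕ)))) =
      optimalWeight (N + 1) (i + 1) := by
    rw [optimalWeight]
    push_cast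
    ring_nf
  simp only [hu] at h
  rw [weightEnergy_succ, ← sum_Icc_one_succ_eq N fun j => optimalWeight (N + 1) j ^ 2] at h
  rw [weightedPenalty, h, mul_div_cancel_right₀ _ hS.ne', Real.sqrt_sq (by positivity), penalty]
  ring

/-- The sequence of lower left corner entries of the periodised sections. -/
def shiftedSuperdiag (A : BiSeq X →L[ℂ] BiSeq X) (n : ℕ) : BddOpSeq X :=
  ⟨fun k => superdiag A (k + n + 1), memℓp_infty ⟨‖superdiag A‖, by
    rintro _ ⟨k, rfl⟩
    exact lp.norm_apply_le_norm (by simp) _ _⟩⟩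

theorem norm_shiftedSuperdiag_le (A : BiSeq X →L[ℂ] BiSeq X) (n : ℕ) :
    ‖shiftedSuperdiag A n‖ ≤ ‖superdiag A‖ :=
  lp.norm_le_of_forall_le (norm_nonneg _) fun _ =>
    lp.norm_apply_le_norm ENNReal.top_ne_zero (superdiag A) _

theorem perOpenSet_eq_genOpenSet (A : BiSeq X →L[ℂ] BiSeq X) (t : ℂ) (n : ℕ) (ε : ℝ) :
    perOpenSet A t n ε =
      genOpenSet A (t • subdiag A) ((starRingEnd ℂ) t • shiftedSuperdiag A n) n ε := rfl

theorem perClosedSet_eq_genClosedSet (A : BiSeq X →L[ℂ] BiSeq X) (t : ℂ) (n : ℕ) (ε : ℝ) :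
    perClosedSet A t n ε =
      genClosedSet A (t • subdiag A) ((starRingEnd ℂ) t • shiftedSuperdiag A n) n ε := rfl

end PiMethod

/-! ### Uniform decrease of the resolvent norm from complex uniform convexity -/

namespace PiMethod

/-- A Fejér kernel estimate for the first two Taylor coefficients of a bounded analytic function. -/
theorem re_add_deriv_le_of_norm_le {h : ℂ → ℂ} {r ρ m : ℝ} (hd : DifferentiableOn ℂ h
    (Metric.ball 0 r)) (hm : ∀ z ∈ Metric.ball (0 : ℂ) r, ‖h z‖ ≤ m) (hρ : 0 < ρ) (hρr : ρ < r)
    {ζ : ℂ} (hζ : ‖ζ‖ ≤ 1) : (h 0 + ζ * (ρ / 2) * deriv h 0).re ≤ m := by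
  have hρ' : (ρ : ℂ) ≠ 0 := by exact_mod_cast hρ.ne'
  have hsub : Metric.closedBall (0 : ℂ) ρ ⊆ Metric.ball 0 r := Metric.closedBall_subset_ball hρr
  have hk : DifferentiableOn ℂ (dslope h 0) (Metric.ball 0 r) :=
    (Complex.differentiableOn_dslope (Metric.ball_mem_nhds _ (hρ.trans hρr))).2 hd
  -- `G` is analytic, and on the circle `|z| = ρ` its real part is `κ (m - Re h)` with the Fejér
  -- kernel `κ = 1 + Re (conj ζ z / ρ) ≥ 0`. The mean value property at `0` turns this sign into the
  -- claim.
  let G : ℂ → ℂ := fun z => m * (1 + starRingEnd ℂ ζ * z / ρ) - (h z + ζ * (ρ / 2) * dslope h 0 z +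
    starRingEnd ℂ ζ * z * h z / (2 * ρ) + starRingEnd ℂ ζ * z * starRingEnd ℂ (h 0) / (2 * ρ))
  have hG : DifferentiableOn ℂ G (Metric.ball 0 r) := by
    simp only [G]
    fun_prop
  have hGc : DiffContOnCl ℂ G (Metric.ball 0 |ρ|) := by
    rw [abs_of_pos hρ]
    exact ((hG.mono hsub).mono Metric.closure_ball_subset_closedBall).diffContOnCl
  have hGi : CircleIntegrable G 0 ρ :=
    ((hG.continuousOn.mono hsub).mono Metric.sphere_subset_closedBall).circleIntegrable hρ.le
  have h1 := Complex.reCLM.circleAverage_comp_comm hGi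
  rw [hGc.circleAverage] at h1
  have h2 : 0 ≤ Real.circleAverage (Complex.reCLM ∘ G) 0 ρ := by
    refine Real.circleAverage_nonneg_of_nonneg fun z hz => ?_
    rw [abs_of_pos hρ, mem_sphere_zero_iff_norm] at hz
    have hz0 : z ≠ 0 := by
      rintro rfl
      simp at hz
      exact hρ.ne hz
    have hzz : starRingEnd ℂ z * z = ρ ^ 2 := by
      rw [mul_comm, Complex.mul_conj, Complex.normSq_eq_norm_sq, hz]
      push_cast
      rfl
    have hsl : h z = h 0 + z * dslope h 0 z := by
      have := sub_smul_dslope h 0 z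
      rw [sub_zero, smul_eq_mul] at this
      rw [this]
      ring
    set κ : ℝ := 1 + (starRingEnd ℂ ζ * z / ρ).re with hκ
    have hκ0 : 0 ≤ κ := by
      have h3 : ‖starRingEnd ℂ ζ * z / ρ‖ ≤ 1 := by
        rw [norm_div, norm_mul, RCLike.norm_conj, hz, Complex.norm_real, Real.norm_of_nonneg hρ.le,
          mul_div_cancel_right₀ _ hρ.ne']
        exact hζ
      linarith [(abs_le.1 (Complex.abs_re_le_norm (starRingEnd ℂ ζ * z / ρ))).1]
    have hκc : (κ : ℂ) = 1 + (starRingEnd ℂ ζ * z / ρ + ζ * starRingEnd ℂ z / ρ) / 2 := by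
      have h3 := Complex.re_eq_add_conj (starRingEnd ℂ ζ * z / ρ)
      rw [hκ, Complex.ofReal_add, h3]
      simp
    have hconj : starRingEnd ℂ z * h z = starRingEnd ℂ z * h 0 + ρ ^ 2 * dslope h 0 z := by
      rw [hsl, mul_add, ← mul_assoc, hzz]
    -- The factor `conj z` in `κ h` is removed by `conj z * z = ρ²`, except for a multiple of `conj
    -- z * h 0`. That remainder is replaced by its conjugate, which leaves the real part unchanged.
    have hkey : κ * h z - (h z + ζ * (ρ / 2) * dslope h 0 z +
        starRingEnd ℂ ζ * z * h z / (2 * ρ) +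
        starRingEnd ℂ ζ * z * starRingEnd ℂ (h 0) / (2 * ρ)) =
        (ζ * starRingEnd ℂ z * h 0 / (2 * ρ)) -
          starRingEnd ℂ (ζ * starRingEnd ℂ z * h 0 / (2 * ρ)) := by
      rw [hκc]
      simp only [map_div₀, map_mul, Complex.conj_conj, Complex.conj_ofReal, map_ofNat]
      field_simp
      linear_combination ζ * hconj
    have hre := congrArg Complex.re hkey
    rw [Complex.sub_re, Complex.sub_re _ (starRingEnd ℂ _), Complex.conj_re, sub_self,
      Complex.re_ofReal_mul, sub_eq_zero] at hre
    have hGre : (G z).re = m * κ - κ * (h z).re := by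
      simp only [G]
      rw [Complex.sub_re, ← hre, Complex.re_ofReal_mul, Complex.add_re, Complex.one_re]
    simp only [Function.comp_apply, Complex.reCLM_apply, hGre]
    have h4 := (Complex.re_le_norm (h z)).trans (hm z (hsub (by simp [hz])))
    nlinarith
  rw [h1] at h2
  have hG0 : Complex.reCLM (G 0) = m - (h 0 + ζ * (ρ / 2) * deriv h 0).re := by
    simp [G, dslope_same]
  linarith

variable {Y : Type*} [NormedAddCommGroup Y] [NormedSpace ℂ Y]

theorem hasDerivAt_resolvent_apply [CompleteSpace Y] (φ : StrongDual ℂ Y) (u : Y) {C : Y →L[ℂ] Y}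
    {z : ℂ} (hz : z ∈ resolventSet ℂ C) :
    HasDerivAt (fun z => φ (resolvent C z u)) (-φ (resolvent C z (resolvent C z u))) z := by
  have h1 := spectrum.hasDerivAt_resolvent_const_left hz
  have h2 := (φ.comp (ContinuousLinearMap.apply ℂ Y u)).hasFDerivAt.comp_hasDerivAt z h1
  refine HasDerivAt.congr_deriv (f := fun z => φ (resolvent C z u)) h2 ?_
  simp [sq]

/-- Apply the scalar Fejér estimate to a norming functional of the left-hand vector. The derivative
of the resolvent is minus its square, so the scalar estimate is used at `-ζ`. -/
theorem norm_resolvent_add_smul_le [CompleteSpace Y] {C : Y →L[ℂ] Y} {u : Y} {r ρ m : ℝ}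
    (hC : ∀ z : ℂ, ‖z‖ < r → z ∈ resolventSet ℂ C ∧ ‖resolvent C z u‖ ≤ m) (hρ : 0 < ρ)
    (hρr : ρ < r) {ζ : ℂ} (hζ : ‖ζ‖ ≤ 1) :
    ‖resolvent C (0 : ℂ) u + ζ • ((ρ / 2 : ℝ) : ℂ) •
      resolvent C (0 : ℂ) (resolvent C (0 : ℂ) u)‖ ≤ m := by
  obtain ⟨φ, hφ, hφv⟩ := exists_dual_vector'' ℂ (resolvent C (0 : ℂ) u + ζ • ((ρ / 2 : ℝ) : ℂ) •
      resolvent C (0 : ℂ) (resolvent C (0 : ℂ) u))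
  have hder (z : ℂ) (hz : z ∈ Metric.ball (0 : ℂ) r) :=
    hasDerivAt_resolvent_apply φ u (hC z (mem_ball_zero_iff.1 hz)).1
  have h := re_add_deriv_le_of_norm_le (h := fun z => φ (resolvent C z u)) (m := m)
    (fun z hz => (hder z hz).differentiableAt.differentiableWithinAt)
    (fun z hz => (φ.le_of_opNorm_le hφ _).trans
      (by simpa using (hC z (mem_ball_zero_iff.1 hz)).2)) hρ hρr (ζ := -ζ) (by simpa using hζ)
  rw [(hder 0 (by simpa using hρ.trans hρr)).deriv] at h
  have h2 : ‖_‖ = (φ _).re := (congrArg Complex.re hφv).symm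
  rw [h2]
  simp only [map_add, map_smul, smul_eq_mul]
  refine le_trans (le_of_eq ?_) h
  congr 1
  push_cast
  ring

/-- Uniform strict decrease of the resolvent norm: if `C - z` has the lower bound `μ` on a disc
around `0`, then `C` has a strictly larger lower bound, uniformly on bounded sets of operators. -/
def UniformResolventGap (Y : Type*) [NormedAddCommGroup Y] [NormedSpace ℂ Y] (μ : ℝ) : Prop :=
  ∀ M r : ℝ, 0 < r → ∃ μ' : ℝ, μ < μ' ∧ ∀ C : Y →L[ℂ] Y, ‖C‖ ≤ M →
    (∀ z : ℂ, ‖z‖ < r → z ∈ resolventSet ℂ C ∧ ∀ x, μ * ‖x‖ ≤ ‖C x - z • x‖) →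
    ∀ x, μ' * ‖x‖ ≤ ‖C x‖

theorem apply_resolvent {C : Y →L[ℂ] Y} {z : ℂ} (hz : z ∈ resolventSet ℂ C) (u : Y) :
    C (resolvent C z u) - z • resolvent C z u = -u := by
  have h := congrArg (fun T : Y →L[ℂ] Y => T u) (Ring.mul_inverse_cancel _ hz)
  have h2 : z • resolvent C z u - C (resolvent C z u) = u := h
  rw [← neg_sub, h2]

theorem resolvent_apply {C : Y →L[ℂ] Y} {z : ℂ} (hz : z ∈ resolventSet ℂ C) (x : Y) :
    resolvent C z (C x - z • x) = -x := by
  have h := congrArg (fun T : Y →L[ℂ] Y => T x) (Ring.inverse_mul_cancel _ hz)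
  have h2 : resolvent C z (z • x - C x) = x := h
  rw [← neg_sub, map_neg, h2]

theorem norm_resolvent_apply_le {C : Y →L[ℂ] Y} {z : ℂ} (hz : z ∈ resolventSet ℂ C) {μ : ℝ}
    (hμ : 0 < μ) (h : ∀ x, μ * ‖x‖ ≤ ‖C x - z • x‖) (u : Y) :
    ‖resolvent C z u‖ ≤ ‖u‖ / μ := by
  have := h (resolvent C z u)
  rw [apply_resolvent hz, norm_neg] at this
  rw [le_div_iff₀ hμ]
  linarith

/-- With `u = C x` the Fejér estimate says that the complex disc with centre `x` and direction a
multiple of `C⁻¹ x` stays in the ball of radius `m = ‖C x‖ / μ`. As `‖C‖ ≤ M`, the direction is not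
small, so convexity forces `‖x‖ ≤ κ m` with `κ < 1` depending only on `M` and `r`. -/
theorem ComplexUniformlyConvex.uniformResolventGap [CompleteSpace Y]
    (hY : ComplexUniformlyConvex Y) {μ : ℝ} (hμ : 0 < μ) : UniformResolventGap Y μ := by
  intro M r hr
  set M' := max M 1
  have hM' : 0 < M' := lt_max_of_lt_right one_pos
  obtain ⟨δ, hδ, hconv⟩ := hY (r / 4 / (2 * M')) (by positivity)
  set κ := max (1 - δ) (1 / 2)
  have hκ0 : 0 < κ := lt_max_of_lt_right (by norm_num)
  have hκ1 : κ < 1 := max_lt (by linarith) (by norm_num)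
  refine ⟨μ / κ, by rw [lt_div_iff₀ hκ0]; nlinarith, fun C hCM hC x => ?_⟩
  have h0 := hC 0 (by simpa using hr)
  set m := ‖C x‖ / μ with hm
  have hx : resolvent C (0 : ℂ) (C x) = -x := by simpa using resolvent_apply h0.1 x
  have hR : ‖x‖ ≤ M' * ‖resolvent C (0 : ℂ) x‖ := by
    have h1 := apply_resolvent h0.1 x
    rw [zero_smul, sub_zero] at h1
    rw [← norm_neg x, ← h1]
    exact C.le_of_opNorm_le (hCM.trans (le_max_left _ _)) _
  have hfej (ζ : ℂ) (hζ : ‖ζ‖ ≤ 1) :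
      ‖x + ζ • ((r / 2 / 2 : ℝ) : ℂ) • resolvent C (0 : ℂ) x‖ ≤ m := by
    have h1 := norm_resolvent_add_smul_le (C := C) (u := C x) (r := r) (ρ := r / 2) (m := m)
      (fun z hz => ⟨(hC z hz).1, norm_resolvent_apply_le (hC z hz).1 hμ (hC z hz).2 _⟩)
      (by linarith) (by linarith) hζ
    rw [hx, map_neg] at h1
    rw [← norm_neg]
    rwa [neg_add, ← smul_neg, ← smul_neg]
  have hxm : ‖x‖ ≤ m := by simpa using hfej 0 (by simp)
  suffices h : ‖x‖ ≤ κ * m by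
    rw [div_mul_eq_mul_div, div_le_iff₀ hκ0]
    calc μ * ‖x‖ ≤ μ * (κ * m) := by gcongr
      _ = ‖C x‖ * κ := by rw [hm]; field_simp
  rcases (norm_nonneg x |>.trans hxm).eq_or_lt with hm0 | hm0
  · rw [← hm0] at hxm ⊢
    linarith
  -- If `‖x‖ ≤ m / 2` the factor `1 / 2` in `κ` suffices; otherwise `C⁻¹ x` has norm at least `m /
  -- (2 M')`, and convexity applies after division by `m`.
  by_cases hxm2 : ‖x‖ ≤ 1 / 2 * m
  · exact hxm2.trans (by gcongr; exact le_max_right _ _)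
  push Not at hxm2
  have h2 := hconv ((m⁻¹ : ℂ) • x) ((m⁻¹ : ℂ) • ((r / 2 / 2 : ℝ) : ℂ) • resolvent C (0 : ℂ) x) ?_ ?_
  · rw [norm_smul, norm_inv, Complex.norm_real, Real.norm_of_nonneg hm0.le, inv_mul_eq_div,
      div_le_iff₀ hm0] at h2
    exact h2.trans (by gcongr; exact le_max_left _ _)
  · rw [norm_smul, norm_inv, norm_smul, Complex.norm_real, Complex.norm_real,
      Real.norm_of_nonneg hm0.le, Real.norm_of_nonneg (by positivity), inv_mul_eq_div,
      le_div_iff₀ hm0]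
    have h3 : m / (2 * M') ≤ ‖resolvent C (0 : ℂ) x‖ := by
      rw [div_le_iff₀ (by positivity)]
      nlinarith
    calc r / 4 / (2 * M') * m = r / 4 * (m / (2 * M')) := by ring
      _ ≤ r / 4 * ‖resolvent C (0 : ℂ) x‖ := by gcongr
      _ = _ := by ring
  · intro ζ hζ
    rw [smul_comm ζ, ← smul_add, norm_smul, norm_inv, Complex.norm_real,
      Real.norm_of_nonneg hm0.le, inv_mul_eq_div, div_le_one hm0]
    exact hfej ζ hζ

end PiMethod

/-! ### Complex uniform convexity of `X^n` and its dual; transposition -/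

namespace PiMethod

/-- Complex uniform convexity passes to finite `ℓ²`-sums. -/
theorem ComplexUniformlyConvex.of_norm_sq_eq_sum {X Y ι : Type*} [NormedAddCommGroup X]
    [NormedSpace ℂ X] [NormedAddCommGroup Y] [NormedSpace ℂ Y] [Fintype ι]
    (hX : ComplexUniformlyConvex X) (p : ι → Y →ₗ[ℂ] X)
    (hp : ∀ y, ‖y‖ ^ 2 = ∑ i, ‖p i y‖ ^ 2) : ComplexUniformlyConvex Y := by
  intro ε hε
  -- Adding `1` gives `card ι < K²` even for empty `ι`, so some coordinate of `y` has norm at least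
  -- `ε / K`.
  set K : ℝ := Fintype.card ι + 1 with hK
  have hK1 : 1 ≤ K := by rw [hK]; linarith [(Fintype.card ι).cast_nonneg (α := ℝ)]
  set ε₁ := ε / K with hε₁
  have hε₁0 : 0 < ε₁ := by positivity
  obtain ⟨δ₁, hδ₁, hconv⟩ := hX (ε₁ / 2) (by positivity)
  set s := min 1 (ε₁ * δ₁) / 4 with hs
  have hs0 : 0 < s := by positivity
  have hs1 : s ≤ 1 / 4 := by linarith [min_le_left 1 (ε₁ * δ₁)]
  have hs2 : 4 * s ≤ ε₁ * δ₁ := by linarith [min_le_right 1 (ε₁ * δ₁)]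
  refine ⟨s ^ 2, by positivity, fun x y hy hxy => ?_⟩
  by_contra! hcon
  set r := ‖x‖ with hr
  have hr1 : r ≤ 1 := by simpa using hxy 0 (by simp)
  have hr0 : 0 < r := by nlinarith
  obtain ⟨i, hi⟩ : ∃ i, ε₁ ≤ ‖p i y‖ := by
    by_contra! h
    have h1 : ‖y‖ ^ 2 ≤ Fintype.card ι * ε₁ ^ 2 := by
      rw [hp, ← nsmul_eq_mul, ← Finset.card_univ, ← Finset.sum_const]
      exact Finset.sum_le_sum fun i _ => pow_le_pow_left₀ (norm_nonneg _) (h i).le 2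
    have h2 : ε ^ 2 = K ^ 2 * ε₁ ^ 2 := by rw [hε₁]; field_simp
    have h3 : ε ^ 2 ≤ ‖y‖ ^ 2 := pow_le_pow_left₀ hε.le hy 2
    have h4 : (Fintype.card ι : ℝ) < K ^ 2 := by nlinarith
    nlinarith [pow_pos hε₁0 2]
  choose g hg hgx using fun j => exists_dual_vector'' ℂ (p j x)
  -- A support functional of `x`, scaled so that `Φ x = r²` and `|Φ| ≤ r` on the unit ball. Rotating
  -- `ζ` then bounds `|Φ y|` by `r - r²`.
  let Φ : Y →ₗ[ℂ] ℂ := ∑ j, (‖p j x‖ : ℂ) • (g j).toLinearMap.comp (p j)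
  have hΦ (v : Y) : Φ v = ∑ j, (‖p j x‖ : ℂ) * g j (p j v) := by simp [Φ]
  have hΦx : Φ x = (r ^ 2 : ℝ) := by
    rw [hΦ, hr, hp, Complex.ofReal_sum]
    refine Finset.sum_congr rfl fun j _ => ?_
    rw [hgx, Complex.ofReal_pow, sq]
    rfl
  have hΦle (v : Y) : ‖Φ v‖ ≤ ∑ j, ‖p j x‖ * ‖p j v‖ := by
    rw [hΦ]
    refine norm_sum_le_of_le _ fun j _ => ?_
    rw [norm_mul, Complex.norm_real, norm_norm]
    gcongr
    simpa using (g j).le_of_opNorm_le (hg j) (p j v)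
  have hsq (v : Y) (hv : ‖v‖ ≤ 1) : ∑ j, ‖p j v‖ ^ 2 ≤ 1 := by
    rw [← hp]
    exact pow_le_one₀ (norm_nonneg _) hv
  have hsqx : ∑ j, ‖p j x‖ ^ 2 = r ^ 2 := by rw [hr, hp]
  have hΦle' (v : Y) (hv : ‖v‖ ≤ 1) : ‖Φ v‖ ≤ r := by
    refine (hΦle v).trans ((Real.sum_mul_le_sqrt_mul_sqrt _ _ _).trans ?_)
    rw [hsqx, Real.sqrt_sq hr0.le]
    have := Real.sqrt_le_sqrt (hsq v hv)
    rw [Real.sqrt_one] at this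
    nlinarith
  have hΦy : r ^ 2 + ‖Φ y‖ ≤ r := by
    obtain ⟨c, hc, hcy⟩ : ∃ c : ℂ, ‖c‖ = 1 ∧ c * Φ y = ‖Φ y‖ := by
      by_cases h0 : Φ y = 0
      · exact ⟨1, by simp, by simp [h0]⟩
      · have h0' : (‖Φ y‖ : ℂ) ≠ 0 := by simpa using h0
        refine ⟨starRingEnd ℂ (Φ y) / ‖Φ y‖, ?_, ?_⟩
        · rw [norm_div, RCLike.norm_conj, Complex.norm_real, norm_norm,
            div_self (norm_ne_zero_iff.2 h0)]
        · rw [div_mul_eq_mul_div, mul_comm, Complex.mul_conj, Complex.normSq_eq_norm_sq,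
            Complex.ofReal_pow, sq, mul_div_assoc, div_self h0', mul_one]
    have h1 := hΦle' _ (hxy c hc.le)
    rw [map_add, map_smul, hΦx, smul_eq_mul, hcy, ← Complex.ofReal_add, Complex.norm_real] at h1
    exact (le_abs_self _).trans h1
  have hclose (ζ : ℂ) (hζ : ‖ζ‖ ≤ 1) : ‖p i (x + ζ • y)‖ ≤ ‖p i x‖ + 2 * s := by
    have h1 : 2 * r ^ 2 - r ≤ ∑ j, ‖p j x‖ * ‖p j (x + ζ • y)‖ := by
      refine le_trans ?_ (hΦle _)
      have h2 : ‖Φ x‖ ≤ ‖Φ (x + ζ • y)‖ + ‖ζ • Φ y‖ := by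
        have : Φ x = Φ (x + ζ • y) - ζ • Φ y := by rw [map_add, map_smul]; abel
        rw [this]
        exact norm_sub_le _ _
      rw [hΦx, Complex.norm_real, Real.norm_of_nonneg (by positivity), norm_smul] at h2
      nlinarith [norm_nonneg (Φ y)]
    -- The coordinate norms of `x + ζ y` and of `x` are close in `ℓ²`: the sum is at most `1 + r² -
    -- 2 (2 r² - r) = (1 - r) (1 + 3 r)`, and `1 - r < s²`.
    have h2 : ∑ j, (‖p j (x + ζ • y)‖ - ‖p j x‖) ^ 2 ≤ 4 * s ^ 2 := by
      have h3 : ∑ j, (‖p j (x + ζ • y)‖ - ‖p j x‖) ^ 2 = ∑ j, ‖p j (x + ζ • y)‖ ^ 2 +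
          ∑ j, ‖p j x‖ ^ 2 - 2 * ∑ j, ‖p j x‖ * ‖p j (x + ζ • y)‖ := by
        rw [Finset.mul_sum, ← Finset.sum_add_distrib, ← Finset.sum_sub_distrib]
        exact Finset.sum_congr rfl fun j _ => by ring
      rw [h3, hsqx]
      nlinarith [hsq _ (hxy ζ hζ)]
    have h3 : (‖p i (x + ζ • y)‖ - ‖p i x‖) ^ 2 ≤ (2 * s) ^ 2 :=
      (Finset.single_le_sum (f := fun j => (‖p j (x + ζ • y)‖ - ‖p j x‖) ^ 2)
        (fun _ _ => sq_nonneg _) (Finset.mem_univ i)).trans (h2.trans_eq (by ring))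
    linarith [le_of_sq_le_sq h3 (by positivity)]
  set L := ‖p i x‖ + 2 * s with hL
  have hyL : ‖p i y‖ ≤ L := by
    have h1 := hclose 1 (by simp)
    have h2 := hclose (-1) (by simp)
    have h3 : (2 : ℂ) • p i y = p i (x + (1 : ℂ) • y) - p i (x + (-1 : ℂ) • y) := by
      rw [← map_sub, ← map_smul]
      congr 1
      module
    have h4 := norm_sub_le (p i (x + (1 : ℂ) • y)) (p i (x + (-1 : ℂ) • y))
    rw [← h3, norm_smul, Complex.norm_ofNat] at h4
    linarith
  have hL0 : 0 < L := by linarith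
  have hL2 : L ≤ 2 := by
    have h1 : ‖p i x‖ ^ 2 ≤ r ^ 2 := by
      rw [← hsqx]
      exact Finset.single_le_sum (f := fun j => ‖p j x‖ ^ 2) (fun _ _ => sq_nonneg _)
        (Finset.mem_univ i)
    linarith [le_of_sq_le_sq h1 hr0.le]
  have hnorm (v : X) : ‖(L⁻¹ : ℂ) • v‖ = ‖v‖ / L := by
    rw [norm_smul, norm_inv, Complex.norm_real, Real.norm_of_nonneg hL0.le, inv_mul_eq_div]
  -- Convexity of `X` in the coordinate `i` gives `2 s = L - ‖p i x‖ ≥ δ₁ L ≥ δ₁ ε₁ ≥ 4 s`, a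
  -- contradiction.
  have h := hconv ((L⁻¹ : ℂ) • p i x) ((L⁻¹ : ℂ) • p i y) ?_ ?_
  · rw [hnorm, div_le_iff₀ hL0] at h
    nlinarith
  · rw [hnorm, le_div_iff₀ hL0]
    nlinarith
  · intro ζ hζ
    rw [smul_comm ζ, ← smul_add, hnorm, div_le_one hL0, ← map_smul, ← map_add]
    exact hclose ζ hζ

variable {X : Type*} [NormedAddCommGroup X] [NormedSpace ℂ X]

theorem ComplexUniformlyConvex.finSeq (hX : ComplexUniformlyConvex X) (n : ℕ) :
    ComplexUniformlyConvex (FinSeq X n) :=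
  hX.of_norm_sq_eq_sum (fun i => (PiLp.proj (𝕜 := ℂ) 2 (fun _ : Fin n => X) i).toLinearMap)
    fun y => PiLp.norm_sq_eq_of_L2 _ y

/-- The embedding of `X` into the `i`-th coordinate of `X^n`. -/
def finSingle (n : ℕ) (i : Fin n) : X →L[ℂ] FinSeq X n :=
  ((PiLp.continuousLinearEquiv 2 ℂ (fun _ : Fin n => X)).symm :
      (Fin n → X) →L[ℂ] FinSeq X n).comp (ContinuousLinearMap.single ℂ (fun _ : Fin n => X) i)

theorem sum_finSingle {n : ℕ} (ξ : FinSeq X n) : ∑ i, finSingle n i (ξ i) = ξ := by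
  simp only [finSingle, ContinuousLinearMap.comp_apply, ← map_sum]
  ext j
  simp [Finset.sum_apply, Pi.single_apply]

/-- The norm of a functional on `X^n` is the `ℓ²`-norm of its components. -/
theorem norm_sq_dual_finSeq {n : ℕ} (φ : StrongDual ℂ (FinSeq X n)) :
    ‖φ‖ ^ 2 = ∑ i, ‖φ.comp (finSingle n i)‖ ^ 2 := by
  set ψ : Fin n → StrongDual ℂ X := fun i => φ.comp (finSingle n i)
  have happ (ξ : FinSeq X n) : φ ξ = ∑ i, ψ i (ξ i) := by
    conv_lhs => rw [← sum_finSingle ξ, map_sum]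
    rfl
  set K := ∑ i, ‖ψ i‖ ^ 2 with hK
  have hK0 : 0 ≤ K := Finset.sum_nonneg fun _ _ => sq_nonneg _
  refine le_antisymm ?_ ?_
  · refine (Real.le_sqrt (norm_nonneg _) hK0).1
      (ContinuousLinearMap.opNorm_le_bound _ (Real.sqrt_nonneg _) fun ξ => ?_)
    rw [happ, ← Real.sqrt_sq (norm_nonneg ξ), PiLp.norm_sq_eq_of_L2]
    exact (norm_sum_le_of_le _ fun i _ => (ψ i).le_opNorm _).trans
      (Real.sum_mul_le_sqrt_mul_sqrt _ _ _)
  · rcases hK0.eq_or_lt with h0 | h0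
    · rw [← h0]
      positivity
    -- The components `ψ i` need not attain their norms, so vectors norming them up to a factor `θ`
    -- are combined with coefficients `‖ψ i‖`; finally `θ` tends to `1`.
    have hθ (θ : ℝ) (hθ0 : 0 ≤ θ) (hθ : θ < 1) : θ * √K ≤ ‖φ‖ := by
      have hx (i : Fin n) : ∃ x : X, ‖x‖ ≤ 1 ∧ ψ i x = ‖ψ i x‖ ∧ θ * ‖ψ i‖ ≤ ‖ψ i x‖ := by
        by_cases hi : ‖ψ i‖ = 0
        · exact ⟨0, by simp, by simp, by simp [hi]⟩
        · have h1 : θ * ‖ψ i‖ < ‖ψ i‖ := by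
            nlinarith [lt_of_le_of_ne (norm_nonneg (ψ i)) (Ne.symm hi)]
          obtain ⟨x, hx1, hx2⟩ := (ψ i).exists_lt_apply_of_lt_opNorm h1
          have hne : ψ i x ≠ 0 := by
            intro h
            rw [h, norm_zero] at hx2
            exact hx2.not_ge (by positivity)
          have hne' : (‖ψ i x‖ : ℂ) ≠ 0 := by simpa using hne
          have hc : ‖starRingEnd ℂ (ψ i x) / ‖ψ i x‖‖ = 1 := by
            rw [norm_div, RCLike.norm_conj, Complex.norm_real, norm_norm,
              div_self (norm_ne_zero_iff.2 hne)]
          have hcx : ψ i ((starRingEnd ℂ (ψ i x) / ‖ψ i x‖) • x) = ‖ψ i x‖ := by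
            rw [map_smul, smul_eq_mul, div_mul_eq_mul_div, mul_comm, Complex.mul_conj,
              Complex.normSq_eq_norm_sq, Complex.ofReal_pow, sq, mul_div_assoc, div_self hne',
              mul_one]
          refine ⟨(starRingEnd ℂ (ψ i x) / ‖ψ i x‖) • x, ?_, ?_, ?_⟩
          · rw [norm_smul, hc, one_mul]
            exact hx1.le
          · rw [hcx, Complex.norm_real, norm_norm]
          · rw [hcx, Complex.norm_real, norm_norm]
            exact hx2.le
      choose x hx1 hx2 hx3 using hx
      let ξ : FinSeq X n := WithLp.toLp 2 fun i => (‖ψ i‖ : ℂ) • x i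
      have hξ : ‖ξ‖ ≤ √K := by
        rw [Real.le_sqrt (norm_nonneg _) hK0, PiLp.norm_sq_eq_of_L2]
        refine Finset.sum_le_sum fun i _ => pow_le_pow_left₀ (norm_nonneg _) ?_ 2
        simp only [ξ]
        rw [norm_smul, Complex.norm_real, norm_norm]
        exact mul_le_of_le_one_right (norm_nonneg _) (hx1 i)
      have hφξ : φ ξ = (∑ i, ‖ψ i‖ * ‖ψ i (x i)‖ : ℝ) := by
        rw [happ, Complex.ofReal_sum]
        refine Finset.sum_congr rfl fun i _ => ?_
        simp only [ξ]
        rw [map_smul, hx2, smul_eq_mul, Complex.ofReal_mul, Complex.norm_real, norm_norm]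
      have h1 : θ * K ≤ ‖φ ξ‖ := by
        rw [hφξ, Complex.norm_real, Real.norm_of_nonneg (by positivity), hK, Finset.mul_sum]
        exact Finset.sum_le_sum fun i _ => by nlinarith [hx3 i, norm_nonneg (ψ i)]
      have h2 : θ * K ≤ ‖φ‖ * √K := h1.trans (φ.le_opNorm_of_le hξ)
      refine le_of_mul_le_mul_right ?_ (Real.sqrt_pos.2 h0)
      rwa [mul_assoc, Real.mul_self_sqrt hK0]
    refine (Real.sqrt_le_left (norm_nonneg _)).1 (le_of_forall_lt fun c hc => ?_)
    by_cases hc0 : c < 0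
    · exact hc0.trans_le (norm_nonneg _)
    push Not at hc0
    obtain ⟨d, hcd, hd⟩ := exists_between hc
    have hK' := Real.sqrt_pos.2 h0
    have h3 := hθ (d / √K) (div_nonneg (hc0.trans hcd.le) hK'.le) ((div_lt_one hK').2 hd)
    rw [div_mul_cancel₀ _ hK'.ne'] at h3
    exact hcd.trans_le h3

theorem ComplexUniformlyConvex.dual_finSeq (hX : ComplexUniformlyConvex (StrongDual ℂ X))
    (n : ℕ) : ComplexUniformlyConvex (StrongDual ℂ (FinSeq X n)) :=
  hX.of_norm_sq_eq_sum
    (fun i => ((ContinuousLinearMap.compL ℂ X (FinSeq X n) ℂ).flip (finSingle n i)).toLinearMap)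
    norm_sq_dual_finSeq

theorem mem_resolventSet_of_inverse {Y : Type*} [NormedAddCommGroup Y] [NormedSpace ℂ Y]
    {T S : Y →L[ℂ] Y} {z : ℂ} (h₁ : ∀ y, z • S y - T (S y) = y) (h₂ : ∀ y, S (z • y - T y) = y) :
    z ∈ resolventSet ℂ T :=
  isUnit_iff_exists.2 ⟨S, ContinuousLinearMap.ext h₁, ContinuousLinearMap.ext h₂⟩

/-- Transposition preserves resolvents and their lower bounds. The improved bound returns to `Y`
through `ψ = φ ∘ C⁻¹` up to sign, where `φ` norms `x`: `‖x‖ = |ψ (C x)| ≤ ‖ψ‖ ‖C x‖`. -/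
theorem UniformResolventGap.of_dual {Y : Type*} [NormedAddCommGroup Y] [NormedSpace ℂ Y] {μ : ℝ}
    (hμ : 0 < μ) (hY : UniformResolventGap (StrongDual ℂ Y) μ) : UniformResolventGap Y μ := by
  intro M r hr
  obtain ⟨μ', hμμ', h⟩ := hY M r hr
  refine ⟨μ', hμμ', fun C hCM hC x => ?_⟩
  let J : (Y →L[ℂ] Y) →L[ℂ] (StrongDual ℂ Y →L[ℂ] StrongDual ℂ Y) :=
    (ContinuousLinearMap.compL ℂ Y Y ℂ).flip
  have hJ (T : Y →L[ℂ] Y) (φ : StrongDual ℂ Y) : J T φ = φ.comp T := rfl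
  have hJC : ‖J C‖ ≤ M := by
    refine (ContinuousLinearMap.opNorm_le_bound _ (norm_nonneg C) fun φ => ?_).trans hCM
    rw [hJ, mul_comm]
    exact φ.opNorm_comp_le C
  have key := h (J C) hJC fun z hz => by
    have hz1 := (hC z hz).1
    refine ⟨?_, fun φ => ?_⟩
    · refine mem_resolventSet_of_inverse (S := J (resolvent C z)) (fun φ => ?_) fun φ => ?_
      · ext y
        have h1 := congrArg φ (resolvent_apply hz1 y)
        rw [map_sub, map_smul, map_neg, map_sub, map_smul] at h1
        have h2 : z • φ (resolvent C z y) - φ (resolvent C z (C y)) = φ y := by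
          rw [← neg_sub, h1, neg_neg]
        exact h2
      · ext y
        have h1 := congrArg φ (apply_resolvent hz1 y)
        rw [map_sub, map_smul, map_neg] at h1
        have h2 : z • φ (resolvent C z y) - φ (C (resolvent C z y)) = φ y := by
          rw [← neg_sub, h1, neg_neg]
        exact h2
    · rw [hJ]
      have h1 : ‖φ‖ ≤ ‖φ.comp C - z • φ‖ / μ := by
        refine ContinuousLinearMap.opNorm_le_bound _ (by positivity) fun y => ?_
        have h2 : (φ.comp C - z • φ) (resolvent C z y) = -φ y := by
          rw [← map_neg, ← apply_resolvent hz1 y, map_sub, map_smul]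
          rfl
        rw [← norm_neg, ← h2]
        refine (ContinuousLinearMap.le_opNorm_of_le _
          (norm_resolvent_apply_le hz1 hμ (hC z hz).2 y)).trans_eq (by ring)
      rw [le_div_iff₀ hμ] at h1
      linarith
  have hz0 := (hC 0 (by simpa using hr)).1
  obtain ⟨φ, hφ, hφx⟩ := exists_dual_vector'' ℂ x
  let ψ : StrongDual ℂ Y := φ.comp (resolvent C (0 : ℂ))
  have hψ (y : Y) : ψ (C y) = -φ y := by
    have := resolvent_apply hz0 y
    rw [zero_smul, sub_zero] at this
    rw [← map_neg, ← this]
    rfl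
  have h1 : J C ψ = -φ := by
    ext y
    exact hψ y
  have h2 := key ψ
  rw [h1, norm_neg] at h2
  have h3 : ‖x‖ ≤ ‖ψ‖ * ‖C x‖ := by
    have h4 : ‖φ x‖ = ‖x‖ := by rw [hφx]; simp
    rw [← h4, ← norm_neg, ← hψ]
    exact ψ.le_opNorm _
  have hμ' : 0 < μ' := hμ.trans hμμ'
  calc μ' * ‖x‖ ≤ (μ' * ‖ψ‖) * ‖C x‖ := by rw [mul_assoc]; gcongr
    _ ≤ 1 * ‖C x‖ := by gcongr; exact h2.trans hφ
    _ = ‖C x‖ := one_mul _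

end PiMethod

/-! ### The resolvent gap in finite dimensions -/

namespace PiMethod

section FiniteDimensional

variable {Y : Type*} [NormedAddCommGroup Y] [NormedSpace ℂ Y] [FiniteDimensional ℂ Y]

theorem mem_resolventSet_of_injective {C : Y →L[ℂ] Y} {z : ℂ}
    (h : ∀ x, C x - z • x = 0 → x = 0) : z ∈ resolventSet ℂ C := by
  have : CompleteSpace Y := FiniteDimensional.complete ℂ Y
  have hinj : Function.Injective (algebraMap ℂ (Y →L[ℂ] Y) z - C) := by
    rw [injective_iff_map_eq_zero]
    intro x hx
    have hx' : z • x - C x = 0 := hx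
    exact h x (by rw [← neg_sub, hx', neg_zero])
  exact ContinuousLinearMap.isUnit_iff_bijective.2
    ⟨hinj, LinearMap.injective_iff_surjective.1 hinj⟩

theorem finite_spectrum_continuousLinearMap (C : Y →L[ℂ] Y) : (spectrum ℂ C).Finite := by
  refine (Module.End.finite_spectrum (C : Y →ₗ[ℂ] Y)).subset fun z hz => ?_
  by_contra hz'
  refine hz (mem_resolventSet_of_injective fun x hx => ?_)
  have h1 := (Module.End.isUnit_iff _).1 (spectrum.notMem_iff.1 hz')
  refine (injective_iff_map_eq_zero _).1 h1.1 x ?_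
  have h2 : z • x - C x = 0 := by rw [← neg_sub, hx, neg_zero]
  exact h2

/-- A positive lower bound for `‖C x‖` on unit vectors, uniform over a compact set of operators. -/
theorem exists_forall_le_of_isCompact {K : Set (Y →L[ℂ] Y)} (hK : IsCompact K) {μ : ℝ}
    (h : ∀ C ∈ K, ∀ x, ‖x‖ = 1 → μ < ‖C x‖) :
    ∃ μ', μ < μ' ∧ ∀ C ∈ K, ∀ x, μ' * ‖x‖ ≤ ‖C x‖ := by
  have : ProperSpace Y := FiniteDimensional.proper ℂ Y
  have hcomp : IsCompact (K ×ˢ Metric.sphere (0 : Y) 1) := hK.prod (isCompact_sphere 0 1)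
  have hcont : ContinuousOn (fun q : (Y →L[ℂ] Y) × Y => ‖q.1 q.2‖) (K ×ˢ Metric.sphere (0 : Y) 1) :=
    (isBoundedBilinearMap_apply.continuous.norm).continuousOn
  have hscale (μ' : ℝ) (C : Y →L[ℂ] Y) (hC : ∀ x, ‖x‖ = 1 → μ' ≤ ‖C x‖) (x : Y) :
      μ' * ‖x‖ ≤ ‖C x‖ := by
    by_cases hx : x = 0
    · simp [hx]
    have hx0 : 0 < ‖x‖ := norm_pos_iff.2 hx
    have h1 := hC ((‖x‖⁻¹ : ℂ) • x) (by
      rw [norm_smul, norm_inv, Complex.norm_real, norm_norm, inv_mul_cancel₀ hx0.ne'])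
    rw [map_smul, norm_smul, norm_inv, Complex.norm_real, norm_norm, inv_mul_eq_div,
      le_div_iff₀ hx0] at h1
    exact h1
  rcases (K ×ˢ Metric.sphere (0 : Y) 1).eq_empty_or_nonempty with he | hne
  · refine ⟨μ + 1, by linarith, fun C hC => hscale _ C fun x hx => ?_⟩
    have : (C, x) ∈ K ×ˢ Metric.sphere (0 : Y) 1 := ⟨hC, by simpa using hx⟩
    rw [he] at this
    exact this.elim
  · obtain ⟨⟨C₀, x₀⟩, ⟨hC₀, hx₀⟩, hmin⟩ := hcomp.exists_isMinOn hne hcont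
    refine ⟨‖C₀ x₀‖, h C₀ hC₀ x₀ (by simpa using hx₀), fun C hC => hscale _ C fun x hx => ?_⟩
    exact hmin (show (C, x) ∈ K ×ˢ Metric.sphere (0 : Y) 1 from ⟨hC, by simpa using hx⟩)

/-- In finite dimensions the resolvent norm has no local maximum. -/
theorem lt_norm_apply_of_forall_le {C : Y →L[ℂ] Y} {r μ : ℝ} (hr : 0 < r) (hμ : 0 < μ)
    (h : ∀ z : ℂ, ‖z‖ < r → ∀ x, μ * ‖x‖ ≤ ‖C x - z • x‖) {x : Y} (hx : ‖x‖ = 1) :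
    μ < ‖C x‖ := by
  have : CompleteSpace Y := FiniteDimensional.complete ℂ Y
  have : Nontrivial Y := ⟨x, 0, by rintro rfl; simp at hx⟩
  by_contra! hle
  have hres (z : ℂ) (hz : ‖z‖ < r) : z ∈ resolventSet ℂ C :=
    mem_resolventSet_of_injective fun y hy => by
      have := h z hz y
      rw [hy, norm_zero] at this
      exact norm_le_zero_iff.1 (by nlinarith [norm_nonneg y])
  have h0 : (0 : ℂ) ∈ resolventSet ℂ C := hres 0 (by simpa using hr)
  obtain ⟨φ, hφ, hφx⟩ := exists_dual_vector'' ℂ x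
  -- If `‖C x‖ ≤ μ`, then `|f|` has a local maximum at `0` with `f 0 = -1`. So `f` is constant near
  -- `0`, hence on the connected complement of the finite spectrum, although the resolvent vanishes
  -- at infinity.
  set f : ℂ → ℂ := fun z => φ (resolvent C z (C x)) with hf
  have hder : DifferentiableOn ℂ f (resolventSet ℂ C) := fun z hz =>
    (hasDerivAt_resolvent_apply φ (C x) hz).differentiableAt.differentiableWithinAt
  have hopen : IsOpen (resolventSet ℂ C) := spectrum.isOpen_resolventSet C
  have hf0 : f 0 = -1 := by
    have h1 := resolvent_apply h0 x
    rw [zero_smul, sub_zero] at h1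
    simp only [hf]
    rw [h1, map_neg, hφx, hx]
    simp
  have hmax : IsLocalMax (norm ∘ f) 0 := by
    filter_upwards [Metric.ball_mem_nhds (0 : ℂ) hr] with z hz
    rw [mem_ball_zero_iff] at hz
    simp only [Function.comp_apply]
    rw [hf0, norm_neg, norm_one]
    have h1 := norm_resolvent_apply_le (hres z hz) hμ (h z hz) (C x)
    have h2 := φ.le_of_opNorm_le hφ (resolvent C z (C x))
    rw [one_mul] at h2
    exact (h2.trans h1).trans ((div_le_one hμ).2 hle)
  have hev : ∀ᶠ z in nhds (0 : ℂ), f z = f 0 :=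
    Complex.eventually_eq_of_isLocalMax_norm
      ((hopen.eventually_mem h0).mono fun z hz => hder.differentiableAt (hopen.mem_nhds hz)) hmax
  have hconn : IsPreconnected (resolventSet ℂ C) := by
    have := ((finite_spectrum_continuousLinearMap C).countable.isConnected_compl_of_one_lt_rank
      (Complex.rank_real_complex ▸ Nat.one_lt_ofNat)).isPreconnected
    rwa [spectrum, compl_compl] at this
  have hEq : Set.EqOn f (fun _ => f 0) (resolventSet ℂ C) :=
    (hder.analyticOnNhd hopen).eqOn_of_preconnected_of_eventuallyEq
      (analyticOnNhd_const) hconn h0 hev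
  have hlim : Filter.Tendsto f (Bornology.cobounded ℂ) (nhds 0) := by
    have h1 := ((φ.comp (ContinuousLinearMap.apply ℂ Y (C x))).continuous.tendsto 0).comp
      (spectrum.resolvent_tendsto_cobounded (𝕜 := ℂ) C)
    rw [map_zero] at h1
    exact h1
  have hlim' : Filter.Tendsto f (Bornology.cobounded ℂ) (nhds (f 0)) := by
    refine tendsto_const_nhds.congr' ?_
    have h1 : (spectrum ℂ C)ᶜ ∈ Bornology.cobounded ℂ :=
      Bornology.isBounded_def.1 (spectrum.isBounded C)
    filter_upwards [h1] with z hz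
    exact (hEq (by simpa [spectrum] using hz)).symm
  have := tendsto_nhds_unique hlim hlim'
  rw [hf0] at this
  norm_num at this

/-- The operators bounded in norm by `M` with lower bound `μ` on the disc form a compact set, so the
pointwise strict inequality becomes uniform. -/
theorem uniformResolventGap_of_finiteDimensional {μ : ℝ} (hμ : 0 < μ) :
    UniformResolventGap Y μ := by
  intro M r hr
  have : ProperSpace (Y →L[ℂ] Y) := FiniteDimensional.proper ℂ _
  have hclosed : IsClosed {C : Y →L[ℂ] Y | ∀ z : ℂ, ‖z‖ < r → ∀ x, μ * ‖x‖ ≤ ‖C x - z • x‖} := by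
    simp only [Set.ofPred_forall]
    refine isClosed_iInter fun z => isClosed_iInter fun _ => isClosed_iInter fun x => ?_
    exact isClosed_le continuous_const (by fun_prop)
  obtain ⟨μ', hμ', h⟩ := exists_forall_le_of_isCompact
    ((isCompact_closedBall (0 : Y →L[ℂ] Y) M).inter_right hclosed)
    fun C hC x hx => lt_norm_apply_of_forall_le hr hμ hC.2 hx
  exact ⟨μ', hμ', fun C hCM hC => h C ⟨by simpa using hCM, fun z hz => (hC z hz).2⟩⟩

/-- The determinant is bounded below when the spectrum avoids a disc around `0`. -/
theorem pow_finrank_le_norm_det {C : Y →L[ℂ] Y} {r : ℝ} (hr : 0 ≤ r)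
    (h : ∀ z : ℂ, ‖z‖ < r → z ∈ resolventSet ℂ C) :
    r ^ Module.finrank ℂ Y ≤ ‖C.det‖ := by
  have hs : (C : Y →ₗ[ℂ] Y).charpoly.Splits := IsAlgClosed.splits _
  have hroot (z : ℂ) (hz : z ∈ (C : Y →ₗ[ℂ] Y).charpoly.roots) : r ≤ ‖z‖ := by
    by_contra! hlt
    have h1 := (Module.End.mem_spectrum_iff_isRoot_charpoly _ _).2 (Polynomial.isRoot_of_mem_roots hz)
    refine h1 ((Module.End.isUnit_iff _).2 ?_)
    have h2 : IsUnit (algebraMap ℂ (Y →L[ℂ] Y) z - C) := h z hlt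
    have : CompleteSpace Y := FiniteDimensional.complete ℂ Y
    exact ContinuousLinearMap.isUnit_iff_bijective.1 h2
  have hdet : C.det = (C : Y →ₗ[ℂ] Y).charpoly.roots.prod :=
    Module.End.det_eq_prod_roots_charpoly_of_splits hs
  have hcard : (C : Y →ₗ[ℂ] Y).charpoly.roots.card = Module.finrank ℂ Y := by
    rw [← hs.natDegree_eq_card_roots, LinearMap.charpoly_natDegree]
  rw [hdet, ← hcard]
  generalize (C : Y →ₗ[ℂ] Y).charpoly.roots = s at hroot
  induction s using Multiset.induction with
  | empty => simp
  | cons a s ih =>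
    rw [Multiset.card_cons, Multiset.prod_cons, norm_mul, pow_succ']
    exact mul_le_mul (hroot a (Multiset.mem_cons_self a s))
      (ih fun z hz => hroot z (Multiset.mem_cons_of_mem hz)) (by positivity) (norm_nonneg _)

/-- For `μ = 0` only invertibility on the disc remains, which is not visibly a closed condition. It
is replaced by the closed condition `r ^ dim ≤ |det C|`. -/
theorem uniformResolventGap_zero_of_finiteDimensional : UniformResolventGap Y 0 := by
  intro M r hr
  have : ProperSpace (Y →L[ℂ] Y) := FiniteDimensional.proper ℂ _
  have hclosed : IsClosed {C : Y →L[ℂ] Y | r ^ Module.finrank ℂ Y ≤ ‖C.det‖} :=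
    isClosed_le continuous_const ContinuousLinearMap.continuous_det.norm
  obtain ⟨μ', hμ', h⟩ := exists_forall_le_of_isCompact
    ((isCompact_closedBall (0 : Y →L[ℂ] Y) M).inter_right hclosed) (μ := 0)
    fun C hC x hx => by
      rw [norm_pos_iff]
      intro h0
      have hdet : (C : Y →ₗ[ℂ] Y).det ≠ 0 := fun h1 => by
        have h2 : r ^ Module.finrank ℂ Y ≤ ‖(C : Y →ₗ[ℂ] Y).det‖ := hC.2
        rw [h1, norm_zero] at h2
        exact h2.not_gt (by positivity)
      have hx0 := (LinearMap.equivOfDetNeZero _ hdet).injective (a₁ := x) (a₂ := 0)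
        (by simpa using h0)
      rw [hx0] at hx
      simp at hx
  exact ⟨μ', hμ', fun C hCM hC => h C
    ⟨by simpa using hCM, pow_finrank_le_norm_det hr.le fun z hz => (hC z hz).1⟩⟩

end FiniteDimensional

/-! ### The closed inclusion -/

variable {X : Type*} [NormedAddCommGroup X]

theorem norm_finSeq_le_sum {n : ℕ} (x : FinSeq X n) : ‖x‖ ≤ ∑ i, ‖x i‖ := by
  refine le_of_sq_le_sq ?_ (by positivity)
  rw [PiLp.norm_sq_eq_of_L2]
  exact Finset.sum_sq_le_sq_sum_of_nonneg fun i _ => norm_nonneg _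

variable [NormedSpace ℂ X]

theorem GlobevnikProperty.uniformResolventGap_finSeq [CompleteSpace X] (hX : GlobevnikProperty X)
    (n : ℕ) {μ : ℝ} (hμ : 0 ≤ μ) (hμ' : 0 < μ ∨ FiniteDimensional ℂ X) :
    UniformResolventGap (FinSeq X n) μ := by
  rcases hμ.eq_or_lt with rfl | hμ
  · have : FiniteDimensional ℂ X := hμ'.resolve_left (lt_irrefl _)
    have : FiniteDimensional ℂ (FinSeq X n) := inferInstance
    exact uniformResolventGap_zero_of_finiteDimensional
  · rcases hX with hX | hX | hX
    · exact uniformResolventGap_of_finiteDimensional hμ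
    · exact (hX.finSeq n).uniformResolventGap hμ
    · exact ((hX.dual_finSeq n).uniformResolventGap hμ).of_dual hμ

theorem mem_resolventSet_sub_smul_one {Y : Type*} [NormedAddCommGroup Y] [NormedSpace ℂ Y]
    {B : Y →L[ℂ] Y} {z w : ℂ} (h : IsUnit (B - (z + w) • (1 : Y →L[ℂ] Y))) :
    w ∈ resolventSet ℂ (B - z • (1 : Y →L[ℂ] Y)) := by
  have h1 : algebraMap ℂ (Y →L[ℂ] Y) w - (B - z • (1 : Y →L[ℂ] Y)) =
      -(B - (z + w) • (1 : Y →L[ℂ] Y)) := by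
    rw [Algebra.algebraMap_eq_smul_one]
    module
  exact (h1 ▸ h.neg : IsUnit (algebraMap ℂ (Y →L[ℂ] Y) w - (B - z • (1 : Y →L[ℂ] Y))))

/-- For a bounded family of operators on a space with a uniform resolvent gap, the intersection of
slightly larger open pseudospectra lies in the closure of the closed pseudospectra. -/
theorem mem_closure_iUnion_closedPseudospectrum {Y : Type*} [NormedAddCommGroup Y]
    [NormedSpace ℂ Y] {ι : Type*} {B : ι → Y →L[ℂ] Y} {M μ : ℝ} (hB : ∀ k, ‖B k‖ ≤ M)
    (hμ : 0 ≤ μ) (hY : UniformResolventGap Y μ) {z : ℂ}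
    (hz : ∀ η, 0 < η → ∃ k, z ∈ openPseudospectrum (μ + η) (B k)) :
    z ∈ closure (⋃ k, closedPseudospectrum μ (B k)) := by
  by_contra hcl
  obtain ⟨r, hr, hball⟩ := Metric.isOpen_iff.1 isClosed_closure.isOpen_compl z hcl
  have hnot (w : ℂ) (hw : ‖w‖ < r) (k : ι) : z + w ∉ closedPseudospectrum μ (B k) := fun h =>
    hball (show z + w ∈ Metric.ball z r by simpa using hw)
      (subset_closure (Set.mem_iUnion.2 ⟨k, h⟩))
  obtain ⟨μ', hμ', h⟩ := hY (M + ‖z‖ * ‖(1 : Y →L[ℂ] Y)‖) r hr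
  -- Taking `η = μ' - μ` contradicts the improved lower bound `μ'`, which holds for all `k` at once.
  obtain ⟨k, hk⟩ := hz (μ' - μ) (by linarith)
  rw [add_sub_cancel] at hk
  refine (notMem_openPseudospectrum_iff (hμ.trans_lt hμ')).2 ⟨?_, ?_⟩ hk
  · simpa using isUnit_of_notMem_closedPseudospectrum (hnot 0 (by simpa using hr) k)
  · refine h _ ((norm_sub_le _ _).trans (add_le_add (hB k) (norm_smul z (1 : Y →L[ℂ] Y)).le)) fun w hw => ?_
    have hun := isUnit_of_notMem_closedPseudospectrum (hnot w hw k)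
    refine ⟨mem_resolventSet_sub_smul_one hun, fun x => ?_⟩
    rcases hμ.eq_or_lt with h0 | h0
    · rw [← h0, zero_mul]
      exact norm_nonneg _
    · have h1 := ((notMem_openPseudospectrum_iff h0).1 fun h2 =>
        hnot w hw k (openPseudospectrum_subset_closedPseudospectrum _ _ h2)).2 x
      refine h1.trans_eq (congrArg _ ?_)
      change B k x - (z + w) • x = B k x - z • x - w • x
      module

theorem norm_matOp_le {n : ℕ} (m : Fin n → Fin n → X →L[ℂ] X) :
    ‖matOp m‖ ≤ ∑ i, ∑ j, ‖m i j‖ := by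
  refine ContinuousLinearMap.opNorm_le_bound _ (by positivity) fun x => ?_
  refine (norm_finSeq_le_sum _).trans ?_
  rw [Finset.sum_mul]
  refine Finset.sum_le_sum fun i _ => ?_
  rw [matOp_apply, Finset.sum_mul]
  exact norm_sum_le_of_le _ fun j _ => (m i j).le_opNorm_of_le (PiLp.norm_apply_le _ _)

theorem norm_genSection_le (A : BiSeq X →L[ℂ] BiSeq X) (𝔞 𝔠 : BddOpSeq X) (n : ℕ) (k : ℤ) :
    ‖genSection A 𝔞 𝔠 n k‖ ≤ ∑ _i : Fin n, ∑ _j : Fin n, (‖A‖ + ‖𝔞‖ + ‖𝔠‖) := by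
  refine (norm_matOp_le _).trans (Finset.sum_le_sum fun i _ => Finset.sum_le_sum fun j _ => ?_)
  refine norm_add₃_le.trans (add_le_add (add_le_add (norm_entry_le _ _ _) ?_) ?_)
  · split_ifs
    · exact lp.norm_apply_le_norm ENNReal.top_ne_zero 𝔞 k
    · simp
  · split_ifs
    · exact lp.norm_apply_le_norm ENNReal.top_ne_zero 𝔠 k
    · simp

/-- The closed pseudospectrum inclusion for general weights. -/
theorem closedPseudospectrum_subset_genClosedSet [CompleteSpace X] (hX : GlobevnikProperty X)
    {A : BiSeq X →L[ℂ] BiSeq X} (hA : IsTridiagonal A) {n : ℕ}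
    (hn : 1 ≤ n) {𝔞 𝔠 : BddOpSeq X} (h𝔞 : ‖𝔞‖ ≤ ‖subdiag A‖) (h𝔠 : ‖𝔠‖ ≤ ‖superdiag A‖)
    {w : ℕ → ℝ} (hw : ∀ j ∈ Finset.Icc 1 n, 0 ≤ w j) (hw0 : ∃ j ∈ Finset.Icc 1 n, w j ≠ 0)
    {ε : ℝ} (hε : 0 ≤ ε)
    (hε' : 0 < ε ∨ 0 < ‖subdiag A‖ + ‖superdiag A‖ ∨ FiniteDimensional ℂ X) :
    closedPseudospectrum ε A ⊆ genClosedSet A 𝔞 𝔠 n (ε + weightedPenalty A n w) := by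
  intro z hz
  have hp := weightedPenalty_nonneg A n w
  refine mem_closure_iUnion_closedPseudospectrum (norm_genSection_le A 𝔞 𝔠 n) (by linarith)
    (hX.uniformResolventGap_finSeq n (by linarith) ?_) fun η hη => ?_
  · rcases hε' with h | h | h
    · exact Or.inl (by linarith)
    · exact Or.inl (by linarith [weightedPenalty_pos hn hw0 h])
    · exact Or.inr h
  · have h1 := openPseudospectrum_subset_genOpenSet hA hn h𝔞 h𝔠 hw hw0 (ε := ε + η) (by linarith)
      (closedPseudospectrum_subset_openPseudospectrum (by linarith) (by linarith) A hz)
    rw [add_right_comm] at h1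
    exact Set.mem_iUnion.1 h1

end PiMethod

/-! ### The shift: its spectrum and its periodised sections -/

namespace PiMethod

section Shift

theorem shift_neg_one_apply (x : BiSeq ℂ) (i : ℤ) :
    (shift (-1) x : BiSeq ℂ) i = x (i - 1) := rfl

theorem isTridiagonal_shift_neg_one : IsTridiagonal (shift (X := ℂ) (-1)) :=
  isTridiagonal_of_apply_eq (a := fun _ => 1) (b := fun _ => 0) (c := fun _ => 0) fun x i => by
    simp [sub_eq_add_neg]

theorem entry_shift_neg_one (i j : ℤ) :
    entry (shift (X := ℂ) (-1)) i j = if i = j + 1 then 1 else 0 := by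
  ext
  rw [entry_apply, shift_neg_one_apply]
  split_ifs with h
  · rw [h, add_sub_cancel_right, lp.single_apply_self]
    rfl
  · rw [lp.single_apply_ne _ _ _ (by lia)]
    rfl

theorem norm_subdiag_shift_neg_one : ‖subdiag (shift (X := ℂ) (-1))‖ = 1 := by
  have h (k : ℤ) : subdiag (shift (X := ℂ) (-1)) k = 1 := by
    rw [subdiag_apply, entry_shift_neg_one, if_pos rfl]
  refine le_antisymm (lp.norm_le_of_forall_le zero_le_one fun k => ?_) ?_
  · rw [h, norm_one]
  · have := lp.norm_apply_le_norm ENNReal.top_ne_zero (subdiag (shift (X := ℂ) (-1))) 0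
    rwa [h, norm_one] at this

theorem superdiag_shift_neg_one : superdiag (shift (X := ℂ) (-1)) = 0 := by
  ext k : 2
  rw [superdiag_apply, entry_shift_neg_one, if_neg (by lia)]
  rfl

/-- The spectrum of the shift contains the unit circle. -/
theorem mem_spectrum_shift_neg_one {z : ℂ} (hz : ‖z‖ = 1) :
    z ∈ spectrum ℂ (shift (X := ℂ) (-1)) := by
  intro h
  have h' : IsUnit (algebraMap ℂ (BiSeq ℂ →L[ℂ] BiSeq ℂ) z - shift (-1)) := h
  -- A preimage of the unit vector at `0` has constant modulus on `i ≥ 0` and on `i ≤ -1`. Square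
  -- summability makes it zero on both sides, against the equation at `0`.
  obtain ⟨x, hx⟩ := (ContinuousLinearMap.isUnit_iff_bijective.1 h').2 (lp.single 2 0 1)
  have hx' (i : ℤ) : z * x i - x (i - 1) = (lp.single 2 0 (1 : ℂ) : BiSeq ℂ) i :=
    congrArg (fun y : BiSeq ℂ => y i) hx
  have hne (i : ℤ) (hi : i ≠ 0) : ‖x i‖ = ‖x (i - 1)‖ := by
    have h1 := hx' i
    rw [lp.single_apply_ne _ _ _ hi, sub_eq_zero] at h1
    rw [← h1, norm_mul, hz, one_mul]
  have hlim : Filter.Tendsto (fun k => ‖x k‖ ^ 2) Filter.cofinite (nhds 0) :=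
    (summable_norm_sq x).tendsto_cofinite_zero
  have hzero (e : ℕ → ℤ) (he : Function.Injective e) (hc : ∀ m, ‖x (e m)‖ = ‖x (e 0)‖) :
      x (e 0) = 0 := by
    have h1 := (hlim.comp he.tendsto_cofinite)
    have h2 : ((fun k => ‖x k‖ ^ 2) ∘ e) = fun _ => ‖x (e 0)‖ ^ 2 := by
      funext m
      simp only [Function.comp_apply, hc m]
    rw [h2] at h1
    simpa using tendsto_nhds_unique tendsto_const_nhds h1
  have hpos : x 0 = 0 := by
    refine hzero (fun m => (m : ℤ)) Nat.cast_injective fun m => ?_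
    induction m with
    | zero => rfl
    | succ m ih =>
      rw [← ih, hne _ (by positivity)]
      congr 2
      push_cast
      ring_nf
  have hneg : x (-1) = 0 := by
    refine hzero (fun m => -1 - (m : ℤ)) (fun a b hab => by simpa using hab) fun m => ?_
    induction m with
    | zero => rfl
    | succ m ih =>
      rw [← ih, hne (-1 - (m : ℤ)) (by lia)]
      congr 2
      push_cast
      ring_nf
  have h0 := hx' 0
  rw [lp.single_apply_self, zero_sub, hpos, hneg] at h0
  simp at h0

variable {N : ℕ} {t z : ℂ}

theorem perSection_shift_apply (t : ℂ) (k : ℤ) (f : ℕ → ℂ) :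
    perSection (shift (X := ℂ) (-1)) t (N + 1) k (WithLp.toLp 2 fun j : Fin (N + 1) => f j) =
      WithLp.toLp 2 fun i : Fin (N + 1) => (fun i : ℕ => if i = 0 then t * f N else f (i - 1)) i := by
  ext i
  refine (cornerSection_apply isTridiagonal_shift_neg_one k _ _ f (Nat.le_of_lt_succ i.2)).trans ?_
  have e1 : entry (shift (X := ℂ) (-1)) (k + 1 + (i : ℕ)) (k + (i : ℕ)) = 1 := by
    rw [entry_shift_neg_one, if_pos (by ring)]
  have e2 : entry (shift (X := ℂ) (-1)) (k + 1 + (i : ℕ)) (k + 1 + (i : ℕ)) = 0 := by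
    rw [entry_shift_neg_one, if_neg (by lia)]
  have e3 : entry (shift (X := ℂ) (-1)) (k + 1 + (i : ℕ)) (k + 2 + (i : ℕ)) = 0 := by
    rw [entry_shift_neg_one, if_neg (by lia)]
  have e4 : subdiag (shift (X := ℂ) (-1)) k = 1 := by
    rw [subdiag_apply, entry_shift_neg_one, if_pos rfl]
  have e5 : superdiag (shift (X := ℂ) (-1)) (k + (N + 1 : ℕ) + 1) = 0 := by
    rw [superdiag_shift_neg_one]
    rfl
  rw [e1, e2, e3, e4, e5]
  simp

theorem exists_eq_toLp (x : FinSeq ℂ N) :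
    ∃ f : ℕ → ℂ, x = WithLp.toLp 2 fun j : Fin N => f j := by
  refine ⟨fun j => if h : j < N then x ⟨j, h⟩ else 0, ?_⟩
  ext j
  simp

theorem norm_perSection_shift_apply (ht : ‖t‖ = 1) (k : ℤ) (x : FinSeq ℂ (N + 1)) :
    ‖perSection (shift (X := ℂ) (-1)) t (N + 1) k x‖ = ‖x‖ := by
  obtain ⟨f, rfl⟩ := exists_eq_toLp x
  rw [perSection_shift_apply, ← sq_eq_sq₀ (norm_nonneg _) (norm_nonneg _), norm_sq_toLp_range,
    norm_sq_toLp_range (fun i : ℕ => if i = 0 then t * f N else f (i - 1)), Finset.sum_range_succ', Finset.sum_range_succ (n := N)]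
  simp [ht]

/-- Descending from the last entry, a kernel vector satisfies `f (N - j) = z^j f N`, and the corner
row closes the cycle to `z^(N+1) f N = t f N`. -/
theorem mem_resolventSet_perSection_shift (k : ℤ) (hz : z ^ (N + 1) ≠ t) :
    z ∈ resolventSet ℂ (perSection (shift (X := ℂ) (-1)) t (N + 1) k) := by
  refine mem_resolventSet_of_injective fun x hx => ?_
  obtain ⟨f, rfl⟩ := exists_eq_toLp x
  rw [perSection_shift_apply, sub_eq_zero] at hx
  have hrow (i : ℕ) (hi : i ≤ N) : (if i = 0 then t * f N else f (i - 1)) = z * f i :=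
    congrArg (fun y : FinSeq ℂ (N + 1) => y ⟨i, Nat.lt_succ_of_le hi⟩) hx
  have hback (j : ℕ) (hj : j ≤ N) : f (N - j) = z ^ j * f N := by
    induction j with
    | zero => simp
    | succ j ih =>
      have h1 := hrow (N - j) (Nat.sub_le _ _)
      rw [if_neg (by lia), ih (by lia)] at h1
      rw [← Nat.sub_sub, h1]
      ring
  have h0 := hrow 0 (Nat.zero_le _)
  have h1 := hback N le_rfl
  rw [Nat.sub_self] at h1
  rw [if_pos rfl, h1] at h0
  have hN : f N = 0 := by
    have h2 : (z ^ (N + 1) - t) * f N = 0 := by linear_combination -h0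
    exact (mul_eq_zero.1 h2).resolve_left (sub_ne_zero.2 hz)
  ext j
  have h3 := hback (N - j) (Nat.sub_le _ _)
  rw [hN, mul_zero, Nat.sub_sub_self (Nat.le_of_lt_succ j.2)] at h3
  exact h3

/-- The quotient `ζ = ω / z` satisfies `ζ^n = -1`, so its argument is an odd multiple of `π / n` and
`|ζ - 1| = 2 |sin (arg ζ / 2)|`. -/
theorem two_mul_sin_le_norm_sub {n : ℕ} (hn : 1 ≤ n) {ω : ℂ} (hz : ‖z‖ = 1)
    (hω : ω ^ n = t) (hzt : z ^ n = -t) (ht : ‖t‖ = 1) :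
    2 * Real.sin (Real.pi / (2 * n)) ≤ ‖ω - z‖ := by
  have hn0 : (0 : ℝ) < n := by exact_mod_cast hn
  have hz0 : z ≠ 0 := norm_ne_zero_iff.1 (by rw [hz]; exact one_ne_zero)
  have ht0 : t ≠ 0 := norm_ne_zero_iff.1 (by rw [ht]; exact one_ne_zero)
  set ζ := ω / z with hζ
  have hζn : ζ ^ n = -1 := by
    rw [hζ, div_pow, hω, hzt, div_neg, div_self ht0]
  have hζ1 : ‖ζ‖ = 1 := by
    have h1 := congrArg norm hζn
    rw [norm_pow, norm_neg, norm_one] at h1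
    exact (pow_eq_one_iff_of_nonneg (norm_nonneg _) (by lia)).1 h1
  have hsub : ‖ω - z‖ = ‖ζ - 1‖ := by
    have : ω - z = (ζ - 1) * z := by rw [hζ]; field_simp
    rw [this, norm_mul, hz, mul_one]
  set θ := Complex.arg ζ with hθ
  have hexp : ζ = Complex.exp (Complex.I * θ) := by
    have := Complex.norm_mul_exp_arg_mul_I ζ
    rw [hζ1, Complex.ofReal_one, one_mul] at this
    rw [mul_comm, hθ, this]
  have habs : Real.pi / n ≤ |θ| := by
    have h1 : Complex.exp (n * (Complex.I * θ)) = Complex.exp (Real.pi * Complex.I) := by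
      rw [Complex.exp_nat_mul, ← hexp, hζn, Complex.exp_pi_mul_I]
    obtain ⟨m, hm⟩ := Complex.exp_eq_exp_iff_exists_int.1 h1
    have h2 : (n : ℝ) * θ = Real.pi * (2 * m + 1) := by
      have h3 : ((n * θ : ℝ) : ℂ) * Complex.I = ((Real.pi * (2 * m + 1) : ℝ) : ℂ) * Complex.I := by
        push_cast
        linear_combination hm
      exact_mod_cast mul_right_cancel₀ Complex.I_ne_zero h3
    have h4 : (1 : ℝ) ≤ |2 * (m : ℝ) + 1| := by
      have : (1 : ℤ) ≤ |2 * m + 1| := Int.one_le_abs (by lia)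
      exact_mod_cast this
    have h5 : (n : ℝ) * |θ| = Real.pi * |2 * (m : ℝ) + 1| := by
      rw [← abs_of_pos hn0, ← abs_mul, h2, abs_mul, abs_of_pos Real.pi_pos]
    rw [div_le_iff₀ hn0, mul_comm, h5]
    nlinarith [Real.pi_pos]
  have hle : |θ| ≤ Real.pi := abs_le.2 ⟨(Complex.neg_pi_lt_arg ζ).le, Complex.arg_le_pi ζ⟩
  have hpos : 0 < Real.pi / n := by positivity
  rw [hsub, hexp, Complex.norm_exp_I_mul_ofReal_sub_one, norm_mul, Real.norm_ofNat,
    Real.norm_eq_abs]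
  have hsin : |Real.sin (θ / 2)| = Real.sin (|θ| / 2) := by
    rw [Real.abs_sin_eq_sin_abs_of_abs_le_pi (by rw [abs_div, abs_two]; linarith), abs_div,
      abs_two]
  rw [hsin]
  refine mul_le_mul_of_nonneg_left (Real.sin_le_sin_of_le_of_le_pi_div_two ?_ ?_ ?_) (by norm_num)
  · have : 0 < Real.pi / (2 * n) := by positivity
    linarith [Real.pi_pos]
  · linarith
  · rw [show Real.pi / (2 * n) = Real.pi / n / 2 by field_simp]
    linarith

/-- A lower bound for normal operators by the distance to the spectrum. -/
theorem le_norm_apply_of_isStarNormal {H : Type*} [NormedAddCommGroup H] [InnerProductSpace ℂ H]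
    [CompleteSpace H] {B : H →L[ℂ] H} [IsStarNormal B] {d : ℝ} (hd : 0 < d)
    (hz : z ∈ resolventSet ℂ B) (h : ∀ ω ∈ spectrum ℂ B, d ≤ ‖ω - z‖) (x : H) :
    d * ‖x‖ ≤ ‖B x - z • x‖ := by
  set R : H →L[ℂ] H := resolvent B z with hR
  have hnorm : IsStarNormal R := by
    have h1 : Commute (star (algebraMap ℂ (H →L[ℂ] H) z - B)) (algebraMap ℂ (H →L[ℂ] H) z - B) := by
      rw [star_sub, ← algebraMap_star_comm]
      exact (Algebra.commute_algebraMap_left _ _).sub_left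
        ((Algebra.commute_algebraMap_right _ _).sub_right (star_comm_self' B))
    refine ⟨?_⟩
    rw [hR, resolvent, ← Ring.inverse_star]
    exact h1.ringInverse_ringInverse
  -- The resolvent is normal, so its norm is its spectral radius; a nonzero spectral value `k` of
  -- `R` comes from the point `z - k⁻¹` of the spectrum of `B`.
  have hRd : ‖R‖ ≤ d⁻¹ := by
    have h1 := IsStarNormal.spectralRadius_eq_nnnorm R
    have h2 : spectralRadius ℂ R ≤ ENNReal.ofReal d⁻¹ := by
      refine iSup₂_le fun k hk => ?_
      by_contra! hlt
      have hk0 : k ≠ 0 := by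
        rintro rfl
        simp at hlt
      have hkd : d⁻¹ < ‖k‖ := by
        have h3 : ENNReal.ofReal d⁻¹ < ENNReal.ofReal ‖k‖ := by
          rw [ofReal_norm]
          exact hlt
        exact (ENNReal.ofReal_lt_ofReal_iff (norm_pos_iff.2 hk0)).1 h3
      have hw : z - k⁻¹ ∈ resolventSet ℂ B := by
        by_contra hw
        have h3 := h _ hw
        rw [sub_sub_cancel_left, norm_neg, norm_inv] at h3
        exact h3.not_gt (inv_lt_of_inv_lt₀ hd hkd)
      refine hk ?_
      have h3 : algebraMap ℂ (H →L[ℂ] H) k - R =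
          algebraMap ℂ (H →L[ℂ] H) k * ((algebraMap ℂ (H →L[ℂ] H) (z - k⁻¹) - B) * R) := by
        have h4 : (algebraMap ℂ (H →L[ℂ] H) z - B) * R = 1 := Ring.mul_inverse_cancel _ hz
        have h5 : algebraMap ℂ (H →L[ℂ] H) k * algebraMap ℂ (H →L[ℂ] H) k⁻¹ = 1 := by
          rw [← map_mul, mul_inv_cancel₀ hk0, map_one]
        rw [map_sub, sub_right_comm, sub_mul, h4, mul_sub, mul_one, ← mul_assoc, h5, one_mul]
      change IsUnit (algebraMap ℂ (H →L[ℂ] H) k - R)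
      rw [h3]
      exact ((isUnit_iff_ne_zero.2 hk0).map (algebraMap ℂ (H →L[ℂ] H))).mul
        (IsUnit.mul hw hz.ringInverse)
    rw [h1] at h2
    have h3 : ENNReal.ofReal ‖R‖ ≤ ENNReal.ofReal d⁻¹ := by
      rw [ofReal_norm]
      exact h2
    exact (ENNReal.ofReal_le_ofReal_iff (by positivity)).1 h3
  have h1 := R.le_of_opNorm_le hRd (B x - z • x)
  rw [hR, resolvent_apply hz, norm_neg, inv_mul_eq_div, le_div_iff₀ hd] at h1
  linarith

end Shift

end PiMethod

/-! ### Sharpness of the penalty -/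

namespace PiMethod

section Sharpness

/-- In finite dimensions an isometry is surjective, hence unitary. -/
theorem isStarNormal_of_norm_map {H : Type*} [NormedAddCommGroup H] [InnerProductSpace ℂ H]
    [FiniteDimensional ℂ H] [CompleteSpace H] {B : H →L[ℂ] H} (hB : ∀ x, ‖B x‖ = ‖x‖) :
    IsStarNormal B := by
  have h1 : star B * B = 1 := B.norm_map_iff_adjoint_comp_self.1 hB
  have hinj : Function.Injective B := by
    rw [injective_iff_map_eq_zero]
    intro x hx
    rw [← norm_eq_zero, ← hB, hx, norm_zero]
  have hun : IsUnit B := ContinuousLinearMap.isUnit_iff_bijective.2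
    ⟨hinj, LinearMap.injective_iff_surjective (f := (B : H →ₗ[ℂ] H)).1 hinj⟩
  have h2 : B * star B = 1 := by
    refine hun.mul_right_cancel ?_
    rw [mul_assoc, h1, mul_one, one_mul]
  exact ⟨by rw [commute_iff_eq, h1, h2]⟩

theorem penalty_shift_neg_one (n : ℕ) :
    penalty (shift (X := ℂ) (-1)) n = 2 * Real.sin (Real.pi / (2 * n)) := by
  rw [penalty, norm_subdiag_shift_neg_one, superdiag_shift_neg_one, norm_zero, add_zero, mul_one]

variable {n : ℕ} {t z : ℂ}

/-- The distance from the spectrum to a point halfway between two eigenvalues is a lower bound for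
the periodised sections of the shift. -/
theorem penalty_mul_norm_le_perSection_shift (hn : 1 ≤ n) (ht : ‖t‖ = 1) (hz : ‖z‖ = 1)
    (hzt : z ^ n = -t) (k : ℤ) (x : FinSeq ℂ n) :
    penalty (shift (X := ℂ) (-1)) n * ‖x‖ ≤
      ‖perSection (shift (X := ℂ) (-1)) t n k x - z • x‖ := by
  obtain ⟨N, rfl⟩ := Nat.exists_eq_succ_of_ne_zero (by lia : n ≠ 0)
  have hnormal : IsStarNormal (perSection (shift (X := ℂ) (-1)) t (N + 1) k) :=
    isStarNormal_of_norm_map (H := EuclideanSpace ℂ (Fin (N + 1)))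
      (norm_perSection_shift_apply ht k)
  have hne : z ^ (N + 1) ≠ t := by
    intro h
    have h1 : z ^ (N + 1) = -t := hzt
    rw [h, eq_comm, neg_eq_self] at h1
    rw [h1, norm_zero] at ht
    exact zero_ne_one ht
  rw [penalty_shift_neg_one]
  refine le_norm_apply_of_isStarNormal (H := EuclideanSpace ℂ (Fin (N + 1))) (mul_pos two_pos
    (Real.sin_pos_of_pos_of_lt_pi (by positivity) ?_))
    (mem_resolventSet_perSection_shift k hne) (fun ω hω => ?_) x
  · rw [div_lt_iff₀ (by positivity)]
    push_cast
    nlinarith [Real.pi_pos, (Nat.cast_nonneg N : (0 : ℝ) ≤ N)]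
  · have hωt : ω ^ (N + 1) = t := by
      by_contra h
      exact hω (mem_resolventSet_perSection_shift k h)
    exact two_mul_sin_le_norm_sub hn hz hωt hzt ht

theorem notMem_openPseudospectrum_of_finiteDimensional {Y : Type*} [NormedAddCommGroup Y]
    [NormedSpace ℂ Y] [FiniteDimensional ℂ Y] {B : Y →L[ℂ] Y} {ε : ℝ} (hε : 0 < ε)
    (h : ∀ x, ε * ‖x‖ ≤ ‖B x - z • x‖) : z ∉ openPseudospectrum ε B := by
  refine (notMem_openPseudospectrum_iff hε).2 ⟨?_, h⟩
  have h1 : z ∈ resolventSet ℂ B := mem_resolventSet_of_injective fun x hx => by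
    have := h x
    rw [hx, norm_zero] at this
    exact norm_le_zero_iff.1 (by nlinarith [norm_nonneg x])
  have h2 : B - z • (1 : Y →L[ℂ] Y) = -(algebraMap ℂ (Y →L[ℂ] Y) z - B) := by
    rw [Algebra.algebraMap_eq_smul_one, neg_sub]
  rw [h2]
  exact IsUnit.neg h1

theorem spectrum_subset_openPseudospectrum {Y : Type*} [NormedAddCommGroup Y] [NormedSpace ℂ Y]
    (B : Y →L[ℂ] Y) {ε : ℝ} (hε : 0 < ε) : spectrum ℂ B ⊆ openPseudospectrum ε B := by
  rw [← closedPseudospectrum_zero]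
  exact closedPseudospectrum_subset_openPseudospectrum hε hε B

theorem exists_pow_eq_neg_of_norm_eq_one (hn : 1 ≤ n) (ht : ‖t‖ = 1) :
    ∃ z : ℂ, ‖z‖ = 1 ∧ z ^ n = -t := by
  obtain ⟨z, hz⟩ := IsAlgClosed.exists_pow_nat_eq (-t) hn
  refine ⟨z, ?_, hz⟩
  have h1 := congrArg norm hz
  rw [norm_pow, norm_neg, ht] at h1
  exact (pow_eq_one_iff_of_nonneg (norm_nonneg _) (by lia)).1 h1

theorem penalty_pos {X : Type*} [NormedAddCommGroup X] [NormedSpace ℂ X]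
    {A : BiSeq X →L[ℂ] BiSeq X} (hn : 1 ≤ n) (hA : 0 < ‖subdiag A‖ + ‖superdiag A‖) :
    0 < penalty A n := by
  rw [← weightedPenalty_optimalWeight A hn]
  exact weightedPenalty_pos hn
    ⟨1, by simpa using hn, (optimalWeight_pos (by simpa using hn)).ne'⟩ hA

/-- The penalty term is best possible for the shift. -/
theorem shift_sharpness (hn : 1 ≤ n) (ht : ‖t‖ = 1) :
    ¬ spectrum ℂ (shift (X := ℂ) (-1)) ⊆
        perOpenSet (shift (X := ℂ) (-1)) t n (penalty (shift (X := ℂ) (-1)) n) ∧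
      ∀ δ : ℝ, 0 ≤ δ → δ < penalty (shift (X := ℂ) (-1)) n →
        ¬ spectrum ℂ (shift (X := ℂ) (-1)) ⊆ perClosedSet (shift (X := ℂ) (-1)) t n δ ∧
        ∃ ε : ℝ, 0 < ε ∧ ¬ openPseudospectrum ε (shift (X := ℂ) (-1)) ⊆
          perOpenSet (shift (X := ℂ) (-1)) t n (ε + δ) := by
  obtain ⟨z, hz, hzt⟩ := exists_pow_eq_neg_of_norm_eq_one hn ht
  set p := penalty (shift (X := ℂ) (-1)) n with hp
  have hp0 : 0 < p := penalty_pos hn (by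
    rw [norm_subdiag_shift_neg_one, superdiag_shift_neg_one]
    simp)
  have hlow := penalty_mul_norm_le_perSection_shift hn ht hz hzt
  have hspec := mem_spectrum_shift_neg_one hz
  have hopen : z ∉ perOpenSet (shift (X := ℂ) (-1)) t n p := fun h => by
    obtain ⟨k, hk⟩ := Set.mem_iUnion.1 h
    exact notMem_openPseudospectrum_of_finiteDimensional hp0 (hlow k) hk
  -- The witness `ε = p - δ` makes `ε + δ = p`. For the closed set, a point `w` within `(p - δ) / 2`
  -- of `z` still has the lower bound `(p + δ) / 2 > δ`.
  refine ⟨fun h => hopen (h hspec), fun δ hδ hδp => ⟨fun h => ?_, p - δ, by linarith, fun h => ?_⟩⟩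
  · obtain ⟨w, hw, hzw⟩ := Metric.mem_closure_iff.1 (h hspec) ((p - δ) / 2) (by linarith)
    obtain ⟨k, hk⟩ := Set.mem_iUnion.1 hw
    refine notMem_openPseudospectrum_of_finiteDimensional (ε := (p + δ) / 2) (by linarith)
      (fun x => ?_) (closedPseudospectrum_subset_openPseudospectrum (by linarith) (by linarith) _ hk)
    have h1 := hlow k x
    have h2 : perSection (shift (X := ℂ) (-1)) t n k x - z • x =
        (perSection (shift (X := ℂ) (-1)) t n k x - w • x) - (z - w) • x := by
      rw [sub_smul]
      abel
    have h3 : ‖(z - w) • x‖ ≤ (p - δ) / 2 * ‖x‖ := by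
      rw [norm_smul, ← dist_eq_norm]
      gcongr
    rw [h2] at h1
    have h4 := norm_sub_le (perSection (shift (X := ℂ) (-1)) t n k x - w • x) ((z - w) • x)
    linarith
  · rw [sub_add_cancel] at h
    exact hopen (h (spectrum_subset_openPseudospectrum _ (by linarith) hspec))

end Sharpness

end PiMethod

end

/-! ### Assembly -/

theorem corollary4p5 :
    -- the inclusions
    (∀ (X : Type*) [NormedAddCommGroup X] [NormedSpace ℂ X] [CompleteSpace X]
        (A : PiMethod.BiSeq X →L[ℂ] PiMethod.BiSeq X), PiMethod.IsTridiagonal A →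
      ∀ n : ℕ, 1 ≤ n →
        -- general corner entries, with the penalty term of any admissible weights
        (∀ 𝔞 𝔠 : PiMethod.BddOpSeq X,
          ‖𝔞‖ ≤ ‖PiMethod.subdiag A‖ → ‖𝔠‖ ≤ ‖PiMethod.superdiag A‖ →
          ∀ w : ℕ → ℝ, (∀ j ∈ Finset.Icc 1 n, 0 ≤ w j) → (∃ j ∈ Finset.Icc 1 n, w j ≠ 0) →
            (∀ ε : ℝ, 0 < ε → PiMethod.openPseudospectrum ε A ⊆
              PiMethod.genOpenSet A 𝔞 𝔠 n (ε + PiMethod.weightedPenalty A n w)) ∧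
            (PiMethod.GlobevnikProperty X → ∀ ε : ℝ, 0 ≤ ε →
              (0 < ε ∨ 0 < ‖PiMethod.subdiag A‖ + ‖PiMethod.superdiag A‖ ∨
                FiniteDimensional ℂ X) →
              PiMethod.closedPseudospectrum ε A ⊆
                PiMethod.genClosedSet A 𝔞 𝔠 n (ε + PiMethod.weightedPenalty A n w))) ∧
        -- general corner entries, with the optimised penalty term
        (∀ 𝔞 𝔠 : PiMethod.BddOpSeq X,
          ‖𝔞‖ ≤ ‖PiMethod.subdiag A‖ → ‖𝔠‖ ≤ ‖PiMethod.superdiag A‖ →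
            (∀ ε : ℝ, 0 < ε → PiMethod.openPseudospectrum ε A ⊆
              PiMethod.genOpenSet A 𝔞 𝔠 n (ε + PiMethod.penalty A n)) ∧
            (PiMethod.GlobevnikProperty X → ∀ ε : ℝ, 0 ≤ ε →
              (0 < ε ∨ 0 < ‖PiMethod.subdiag A‖ + ‖PiMethod.superdiag A‖ ∨
                FiniteDimensional ℂ X) →
              PiMethod.closedPseudospectrum ε A ⊆
                PiMethod.genClosedSet A 𝔞 𝔠 n (ε + PiMethod.penalty A n))) ∧
        -- periodised finite sections
        (∀ t : ℂ, ‖t‖ = 1 →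
            (∀ ε : ℝ, 0 < ε → PiMethod.openPseudospectrum ε A ⊆
              PiMethod.perOpenSet A t n (ε + PiMethod.penalty A n)) ∧
            (PiMethod.GlobevnikProperty X → ∀ ε : ℝ, 0 ≤ ε →
              (0 < ε ∨ 0 < ‖PiMethod.subdiag A‖ + ‖PiMethod.superdiag A‖ ∨
                FiniteDimensional ℂ X) →
              PiMethod.closedPseudospectrum ε A ⊆
                PiMethod.perClosedSet A t n (ε + PiMethod.penalty A n)))) ∧
    -- sharpness: the shift operator on `ℓ²(ℤ)`
    (∃ V : PiMethod.BiSeq ℂ →L[ℂ] PiMethod.BiSeq ℂ,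
      (∀ (x : PiMethod.BiSeq ℂ) (i : ℤ), (V x : PiMethod.BiSeq ℂ) i = x (i - 1)) ∧
      PiMethod.IsTridiagonal V ∧
      ‖PiMethod.subdiag V‖ = 1 ∧ ‖PiMethod.superdiag V‖ = 0 ∧
      ∀ n : ℕ, 1 ≤ n → ∀ t : ℂ, ‖t‖ = 1 →
        ¬ spectrum ℂ V ⊆ PiMethod.perOpenSet V t n (PiMethod.penalty V n) ∧
        ∀ δ : ℝ, 0 ≤ δ → δ < PiMethod.penalty V n →
          ¬ spectrum ℂ V ⊆ PiMethod.perClosedSet V t n δ ∧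
          ∃ ε : ℝ, 0 < ε ∧
            ¬ PiMethod.openPseudospectrum ε V ⊆ PiMethod.perOpenSet V t n (ε + δ)) := by
  refine ⟨?_, PiMethod.shift (-1), PiMethod.shift_neg_one_apply,
    PiMethod.isTridiagonal_shift_neg_one, PiMethod.norm_subdiag_shift_neg_one,
    by rw [PiMethod.superdiag_shift_neg_one, norm_zero],
    fun n hn t ht => PiMethod.shift_sharpness hn ht⟩
  intro X _ _ _ A hA n hn
  have hgen : ∀ 𝔞 𝔠 : PiMethod.BddOpSeq X,
      ‖𝔞‖ ≤ ‖PiMethod.subdiag A‖ → ‖𝔠‖ ≤ ‖PiMethod.superdiag A‖ →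
      ∀ w : ℕ → ℝ, (∀ j ∈ Finset.Icc 1 n, 0 ≤ w j) → (∃ j ∈ Finset.Icc 1 n, w j ≠ 0) →
        (∀ ε : ℝ, 0 < ε → PiMethod.openPseudospectrum ε A ⊆
          PiMethod.genOpenSet A 𝔞 𝔠 n (ε + PiMethod.weightedPenalty A n w)) ∧
        (PiMethod.GlobevnikProperty X → ∀ ε : ℝ, 0 ≤ ε →
          (0 < ε ∨ 0 < ‖PiMethod.subdiag A‖ + ‖PiMethod.superdiag A‖ ∨
            FiniteDimensional ℂ X) →
          PiMethod.closedPseudospectrum ε A ⊆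
            PiMethod.genClosedSet A 𝔞 𝔠 n (ε + PiMethod.weightedPenalty A n w)) :=
    fun 𝔞 𝔠 h𝔞 h𝔠 w hw hw0 =>
      ⟨fun ε hε => PiMethod.openPseudospectrum_subset_genOpenSet hA hn h𝔞 h𝔠 hw hw0 hε,
        fun hX ε hε hε' =>
          PiMethod.closedPseudospectrum_subset_genClosedSet hX hA hn h𝔞 h𝔠 hw hw0 hε hε'⟩
  have hopt := fun 𝔞 𝔠 h𝔞 h𝔠 => hgen 𝔞 𝔠 h𝔞 h𝔠 (PiMethod.optimalWeight n)
    (fun j hj => (PiMethod.optimalWeight_pos hj).le)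
    ⟨1, by simpa using hn, (PiMethod.optimalWeight_pos (by simpa using hn)).ne'⟩
  simp only [PiMethod.weightedPenalty_optimalWeight A hn] at hopt
  refine ⟨hgen, hopt, fun t ht => ?_⟩
  simp only [PiMethod.perOpenSet_eq_genOpenSet, PiMethod.perClosedSet_eq_genClosedSet]
  exact hopt (t • PiMethod.subdiag A) ((starRingEnd ℂ) t • PiMethod.shiftedSuperdiag A n)
    (by rw [norm_smul, ht, one_mul])
    (by rw [norm_smul, RCLike.norm_conj, ht, one_mul]; exact PiMethod.norm_shiftedSuperdiag_le A n)
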